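/- Work with structures $(N,S,0,1,+,\cdot,<)$ for the language of second-order arithmetic, where number variables range over $N$ and set variables range over $S\subseteq\mathcal P(N)$, $S\neq\emptyset$. $\mathsf{RCA}_0$ consists of the basic (discretely ordered semiring) axioms together with $\Sigma^0_1$ induction and $\Delta^0_1$ comprehension, and $\mathsf{B}\Pi^0_1$ is the scheme $$\forall n\,[(\forall x<n)(\exists y)\,\varphi(x,y)\to(\exists m)(\forall x<n)(\exists y<m)\,\varphi(x,y)]\qquad(\varphi\in\Pi^0_1),$$ all schemes being taken with number and set parameters. Pairs, finite binary strings ($2^{<\mathbb N}$) and nonnegative rationals ($\mathbb Q^{\ge 0}$) are coded by numbers in the usual way, and functions are identified with their (coded) graphs. Within such a structure: * A *martingale approximation* is a function $M:2^{<\mathbb N}\times\mathbb N\to\mathbb Q^{\ge0}$ such that for every $\sigma$ the value $M(\sigma,s)$ is the same for all sufficiently large $s$, and $2M(\sigma,s)=M(\sigma0,s)+M(\sigma1,s)$ for all $\sigma$ and $s$. * A *stable coloring* is a function $f:[\mathbb N]^2\to\{0,1\}$, written $f(x,s)$ for $x<s$, such that $\lim_s f(x,s)$ exists for every $x$. * $M$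 *succeeds on* $f$ if $$(\forall n)(\exists\sigma)(\exists s)(\forall t\ge s)\big[(\forall x<|\sigma|)\,\sigma(x)=f(x,t)\ \wedge\ M(\sigma,t)=M(\sigma,s)>n\big],$$ where $\sigma(x)=f(x,t)$ is understood to include $x<t$. * $f\le_T M$ means that $f$ is $\Delta^0_1$ in $M$, i.e. it has both a $\Sigma^0_1$ and a $\Pi^0_1$ definition whose only set parameter is $M$ (number parameters are allowed). **Lemma.** The following is provable in $\mathsf{RCA}_0+\mathsf{B}\Pi^0_1$, i.e. it holds in every model of $\mathsf{RCA}_0+\mathsf{B}\Pi^0_1$: for every martingale approximation $M$ there is a stable coloring $f\le_T M$ on which $M$ does not succeed. -/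

import Mathlib

/-!
Second-order arithmetic. An `L₂`-structure is a type `N` with `0, 1, +, ·, <`, together with a
nonempty family `S : Set (Set N)`; number variables range over `N` and set variables over `S`.
-/

namespace SOA

/-! ### Syntax of bounded formulas -/

/-- Numerical terms of `L₂`. -/
inductive Tm where
  | var : ℕ → Tm
  | zero : Tm
  | one : Tm
  | add : Tm → Tm → Tm
  | mul : Tm → Tm → Tm

/-- `Σ⁰₀` formulas of `L₂`: all quantifiers are bounded number quantifiers. Number variables are
de Bruijn indices; `ball t φ` is `∀ x < t, φ`, where `x` is variable `0` of `φ` and does not occur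
in `t`, and the other variables are shifted by one. `mem t k` is `t ∈ X_k`. -/
inductive Fm where
  | eq : Tm → Tm → Fm
  | lt : Tm → Tm → Fm
  | mem : Tm → ℕ → Fm
  | neg : Fm → Fm
  | and : Fm → Fm → Fm
  | ball : Tm → Fm → Fm

section Semantics

variable {N : Type*} [Zero N] [One N] [Add N] [Mul N] [LT N]

/-- The assignment `x, v 0, v 1, …`. -/
def scons (x : N) (v : ℕ → N) : ℕ → N
  | 0 => x
  | k + 1 => v k

/-- Value of a term under an assignment of the number variables. -/
def Tm.val (v : ℕ → N) : Tm → N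
  | .var k => v k
  | .zero => 0
  | .one => 1
  | .add s t => s.val v + t.val v
  | .mul s t => s.val v * t.val v

/-- Satisfaction of a `Σ⁰₀` formula; `v` assigns the number variables, `X` the set variables. -/
def Fm.Sat (X : ℕ → Set N) : (ℕ → N) → Fm → Prop
  | v, .eq s t => s.val v = t.val v
  | v, .lt s t => s.val v < t.val v
  | v, .mem t k => t.val v ∈ X k
  | v, .neg φ => ¬ φ.Sat X v
  | v, .and φ ψ => φ.Sat X v ∧ ψ.Sat X v
  | v, .ball t φ => ∀ x, x < t.val v → φ.Sat X (scons x v)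

/-- Satisfaction of the `Σ⁰₁` formula `∃ y, θ`, where `y` is variable `0` of `θ`. -/
def SigmaSat (X : ℕ → Set N) (v : ℕ → N) (θ : Fm) : Prop :=
  ∃ y, θ.Sat X (scons y v)

/-- Satisfaction of the `Π⁰₁` formula `∀ y, θ`, where `y` is variable `0` of `θ`. -/
def PiSat (X : ℕ → Set N) (v : ℕ → N) (θ : Fm) : Prop :=
  ∀ y, θ.Sat X (scons y v)

/-! ### The axiom systems -/

/-- `(N, S)` is a model of `RCA₀`: the basic axioms, `Σ⁰₁` induction and `Δ⁰₁` comprehension,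
the schemes with number parameters from `N` and set parameters from `S`. -/
structure RCA0 (S : Set (Set N)) : Prop where
  sets_nonempty : S.Nonempty
  add_one_ne_zero : ∀ n : N, n + 1 ≠ 0
  add_one_inj : ∀ m n : N, m + 1 = n + 1 → m = n
  add_zero : ∀ m : N, m + 0 = m
  add_add_one : ∀ m n : N, m + (n + 1) = (m + n) + 1
  mul_zero : ∀ m : N, m * 0 = 0
  mul_add_one : ∀ m n : N, m * (n + 1) = m * n + m
  not_lt_zero : ∀ m : N, ¬ m < 0
  lt_add_one_iff : ∀ m n : N, m < n + 1 ↔ (m < n ∨ m = n)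
  sigma_induction : ∀ (φ : Fm) (v : ℕ → N) (X : ℕ → Set N), (∀ k, X k ∈ S) →
    SigmaSat X (scons 0 v) φ →
    (∀ n, SigmaSat X (scons n v) φ → SigmaSat X (scons (n + 1) v) φ) →
    ∀ n, SigmaSat X (scons n v) φ
  delta_comprehension : ∀ (φ ψ : Fm) (v : ℕ → N) (X : ℕ → Set N), (∀ k, X k ∈ S) →
    (∀ n, SigmaSat X (scons n v) φ ↔ PiSat X (scons n v) ψ) →
    ∃ Y ∈ S, ∀ n, n ∈ Y ↔ SigmaSat X (scons n v) φ

/-- `(N, S)` satisfies the `Π⁰₁` bounding scheme: for every `Π⁰₁` formula `φ(x, y)`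
(with parameters), `∀ n, (∀ x < n) (∃ y) φ → (∃ m) (∀ x < n) (∃ y < m) φ`. -/
def BPi01 (S : Set (Set N)) : Prop :=
  ∀ (φ : Fm) (v : ℕ → N) (X : ℕ → Set N), (∀ k, X k ∈ S) → ∀ n : N,
    (∀ x, x < n → ∃ y, PiSat X (scons y (scons x v)) φ) →
    ∃ m, ∀ x, x < n → ∃ y, y < m ∧ PiSat X (scons y (scons x v)) φ

/-- `A ≤_T B` in a structure with number universe `N`: `A` has a `Σ⁰₁` and a `Π⁰₁` definition
with `B` as the only set parameter (and number parameters from `N`, which play the role of the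
possibly nonstandard index of the reduction). -/
def TuringLE (A B : Set N) : Prop :=
  ∃ (φ ψ : Fm) (v : ℕ → N), ∀ n,
    (n ∈ A ↔ SigmaSat (fun _ => B) (scons n v) φ) ∧
    (n ∈ A ↔ PiSat (fun _ => B) (scons n v) ψ)

/-! ### Coding inside the structure -/

/-- `a ≤ b`. -/
def Leq (a b : N) : Prop := a < b ∨ a = b

/-- The code `(i + j)² + i` of the ordered pair `(i, j)`. -/
def pair (i j : N) : N := (i + j) * (i + j) + i

/-- `p` has the form `((ℓ, m), n)`; such a number describes a binary string of length `ℓ`. -/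
def HasLen (p ℓ : N) : Prop := ∃ m n, p = pair (pair ℓ m) n

/-- The binary string described by `p = ((ℓ, m), n)` has the value `1` at `x < ℓ`:
`m (x + 1) + 1` divides `n`. -/
def BitOne (p x : N) : Prop :=
  ∃ ℓ m n, p = pair (pair ℓ m) n ∧ x < ℓ ∧ ∃ d, n = (m * (x + 1) + 1) * d

/-- `σ` is the code of a binary string of length `ℓ`, i.e. the least number that describes
this string. -/
def IsString (σ ℓ : N) : Prop :=
  HasLen σ ℓ ∧ ∀ p, p < σ → HasLen p ℓ → ∃ x, x < ℓ ∧ ¬ (BitOne p x ↔ BitOne σ x)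

/-- `σ(x) = i`, where `σ` codes a binary string of length greater than `x`. -/
def StringVal (σ x i : N) : Prop := (BitOne σ x ∧ i = 1) ∨ (¬ BitOne σ x ∧ i = 0)

/-- `τ` is the code of the string `σ` followed by the single entry `i`. -/
def IsAppend (σ i τ : N) : Prop :=
  ∃ ℓ, IsString σ ℓ ∧ IsString τ (ℓ + 1) ∧ StringVal τ ℓ i ∧
    ∀ x, x < ℓ → (BitOne τ x ↔ BitOne σ x)

/-- `q` is the code of the nonnegative rational `a / b`, given in lowest terms. -/
def IsRat (q a b : N) : Prop :=
  q = pair a b ∧ 0 < b ∧ ∀ d a' b', a = d * a' → b = d * b' → d = 1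

/-- `(x, y)` belongs to the graph `F`, i.e. `F(x) = y` if `F` is a function. -/
def Maps (F : Set N) (x y : N) : Prop := pair x y ∈ F

/-- `F` is (the graph of) a function with domain `D` and values in `C`. -/
def IsFun (F : Set N) (D C : N → Prop) : Prop :=
  (∀ z ∈ F, ∃ x y, D x ∧ C y ∧ z = pair x y) ∧ ∀ x, D x → ∃! y, Maps F x y

/-! ### Martingale approximations and stable colorings -/

/-- `M` is a martingale approximation: a function `2^{<ℕ} × ℕ → ℚ^{≥0}` such that
`lim_s M(σ, s)` exists for all `σ`, and `2 M(σ, s) = M(σ0, s) + M(σ1, s)` for all `σ, s`.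
The last equation is written with numerators and denominators. -/
structure IsMartingaleApprox (M : Set N) : Prop where
  isFun : IsFun M (fun z => ∃ σ ℓ s, IsString σ ℓ ∧ z = pair σ s) (fun q => ∃ a b, IsRat q a b)
  limit : ∀ σ ℓ, IsString σ ℓ → ∃ u, ∀ s t, Leq u s → Leq u t →
    ∀ q r, Maps M (pair σ s) q → Maps M (pair σ t) r → q = r
  average : ∀ σ τ₀ τ₁ s, IsAppend σ 0 τ₀ → IsAppend σ 1 τ₁ →
    ∀ q a b q₀ a₀ b₀ q₁ a₁ b₁, IsRat q a b → IsRat q₀ a₀ b₀ → IsRat q₁ a₁ b₁ →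
    Maps M (pair σ s) q → Maps M (pair τ₀ s) q₀ → Maps M (pair τ₁ s) q₁ →
    (1 + 1) * a * (b₀ * b₁) = b * (a₀ * b₁ + a₁ * b₀)

/-- `f` is a coloring `[ℕ]² → {0, 1}`, a pair of numbers being given in increasing order. -/
def IsColoring (f : Set N) : Prop :=
  IsFun f (fun z => ∃ x s, x < s ∧ z = pair x s) (fun i => i = 0 ∨ i = 1)

/-- `f` is a stable coloring: `lim_s f(x, s)` exists for every `x`. -/
def IsStableColoring (f : Set N) : Prop :=
  IsColoring f ∧ ∀ x, ∃ s i, ∀ t, Leq s t → Maps f (pair x t) i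

/-- `M` succeeds on `f`: for every `n` there are a string `σ` and a number `s` such that for all
`t ≥ s`: `σ(x) = f(x, t)` for all `x < |σ|`, and `M(σ, t) = M(σ, s) > n`. -/
def SucceedsOn (M f : Set N) : Prop :=
  ∀ n : N, ∃ σ ℓ s, IsString σ ℓ ∧ ∀ t, Leq s t →
    (∀ x, x < ℓ → ∃ i, StringVal σ x i ∧ Maps f (pair x t) i) ∧
    ∃ q a b, IsRat q a b ∧ Maps M (pair σ t) q ∧ Maps M (pair σ s) q ∧ n * b < a

end Semantics

end SOA

/-! At every stage `s` fairness lets one descend the binary tree without gaining capital: pass from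
σ to σ0 unless M(σ0,s) > M(σ,s), in which case averaging gives M(σ1,s) ≤ M(σ,s). Let f(x,s) be the
entry at x of the string of length s built this way at stage s.

Along this greedy string the capital never exceeds M(ε,s) (`exists_greedy_le`). Any σ that matches
f(·,t) is a prefix of the greedy string at stage t, so once M(ε,·) has reached its limit, M(σ,t) is
at most that limit, and M does not succeed (`not_succeedsOn`). The entry at x depends only on the
values of M at strings of length at most x + 1. There is a bounded set of codes of these, so BΠ⁰₁
gives one stage after which all those values are constant (`exists_stage_forall`), and f is stable.
This is the only use of BΠ⁰₁. Since the greedy string exists and is unique, f is Δ⁰₁ in M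
(`mem_greedyColoring_iff`).

The remaining work formalizes this inside the model: classes `IsTm`, `D0`, `Sig`, `Pi` let instance
search certify the complexity of each formula used in an induction, and string codes are handled by
divisibility as in Gödel's β function. -/

namespace SOA

/-! ### Semantic definability -/

section Definability

variable {N : Type*} [Zero N] [One N] [Add N] [Mul N]

/-- Simultaneous substitution in terms. -/
def Tm.subst (s : ℕ → Tm) : Tm → Tm
  | .var k => s k
  | .zero => .zero
  | .one => .one
  | .add a b => .add (a.subst s) (b.subst s)
  | .mul a b => .mul (a.subst s) (b.subst s)

/-- The substitution `s` under one more binder. -/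
def liftSubst (s : ℕ → Tm) : ℕ → Tm
  | 0 => .var 0
  | k + 1 => (s k).subst fun i => .var (i + 1)

/-- Simultaneous substitution in `Σ⁰₀` formulas. -/
def Fm.subst : (ℕ → Tm) → Fm → Fm
  | s, .eq a b => .eq (a.subst s) (b.subst s)
  | s, .lt a b => .lt (a.subst s) (b.subst s)
  | s, .mem a k => .mem (a.subst s) k
  | s, .neg φ => .neg (φ.subst s)
  | s, .and φ ψ => .and (φ.subst s) (ψ.subst s)
  | s, .ball t φ => .ball (t.subst s) (φ.subst (liftSubst s))

theorem Tm.val_subst (s : ℕ → Tm) (v : ℕ → N) (t : Tm) :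
    (t.subst s).val v = t.val fun k => (s k).val v := by
  induction t with
  | var | zero | one => rfl
  | add a b ha hb => simp only [Tm.subst, Tm.val, ha, hb]
  | mul a b ha hb => simp only [Tm.subst, Tm.val, ha, hb]

theorem val_liftSubst (s : ℕ → Tm) (x : N) (v : ℕ → N) :
    (fun k => (liftSubst s k).val (scons x v)) = scons x fun k => (s k).val v := by
  funext k
  cases k with
  | zero => rfl
  | succ k => exact Tm.val_subst _ _ _

/-- `f` is the value of a term. -/
class IsTm (f : (ℕ → N) → N) : Prop where
  out : ∃ t : Tm, ∀ v, f v = t.val v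

instance (k : ℕ) : IsTm fun v : ℕ → N => v k := ⟨.var k, fun _ => rfl⟩
instance : IsTm fun _ : ℕ → N => (0 : N) := ⟨.zero, fun _ => rfl⟩
instance : IsTm fun _ : ℕ → N => (1 : N) := ⟨.one, fun _ => rfl⟩

instance (f g : (ℕ → N) → N) [hf : IsTm f] [hg : IsTm g] : IsTm fun v => f v + g v :=
  let ⟨a, ha⟩ := hf.out
  let ⟨b, hb⟩ := hg.out
  ⟨.add a b, fun v => by simp only [Tm.val, ha, hb]⟩

instance (f g : (ℕ → N) → N) [hf : IsTm f] [hg : IsTm g] : IsTm fun v => f v * g v :=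
  let ⟨a, ha⟩ := hf.out
  let ⟨b, hb⟩ := hg.out
  ⟨.mul a b, fun v => by simp only [Tm.val, ha, hb]⟩

instance (f g : (ℕ → N) → N) [IsTm f] [IsTm g] : IsTm fun v => pair (f v) (g v) := by
  unfold pair; infer_instance

theorem IsTm.tail {f : (ℕ → N) → N} (h : IsTm f) : IsTm fun v => f fun k => v (k + 1) := by
  obtain ⟨t, ht⟩ := h.out
  exact ⟨t.subst fun i => .var (i + 1), fun v => by rw [Tm.val_subst, ht]; rfl⟩

variable [LT N]

theorem Fm.sat_subst (X : ℕ → Set N) (φ : Fm) (s : ℕ → Tm) (v : ℕ → N) :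
    (φ.subst s).Sat X v ↔ φ.Sat X fun k => (s k).val v := by
  induction φ generalizing s v with
  | eq a b => simp only [Fm.subst, Fm.Sat, Tm.val_subst]
  | lt a b => simp only [Fm.subst, Fm.Sat, Tm.val_subst]
  | mem a k => simp only [Fm.subst, Fm.Sat, Tm.val_subst]
  | neg φ h => simp only [Fm.subst, Fm.Sat, h]
  | and φ ψ h h' => simp only [Fm.subst, Fm.Sat, h, h']
  | ball t φ h => simp only [Fm.subst, Fm.Sat, h, Tm.val_subst, val_liftSubst]

variable (M : Set N)

/-- `P` is defined by a `Σ⁰₀` formula with the set parameter `M`. -/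
class D0 (P : (ℕ → N) → Prop) : Prop where
  out : ∃ φ : Fm, ∀ v, P v ↔ φ.Sat (fun _ => M) v

/-- `P` is defined by a `Σ⁰₁` formula with the set parameter `M`. -/
class Sig (P : (ℕ → N) → Prop) : Prop where
  out : ∃ φ : Fm, ∀ v, P v ↔ SigmaSat (fun _ => M) v φ

/-- `P` is defined by a `Π⁰₁` formula with the set parameter `M`. -/
class Pi (P : (ℕ → N) → Prop) : Prop where
  out : Sig M fun v => ¬ P v

variable {M}

theorem Pi.exists_formula {P : (ℕ → N) → Prop} (h : Pi M P) :
    ∃ φ : Fm, ∀ v, P v ↔ PiSat (fun _ => M) v φ := by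
  obtain ⟨φ, hφ⟩ := h.out.out
  refine ⟨.neg φ, fun v => ?_⟩
  rw [← not_iff_not, hφ]
  simp only [SigmaSat, PiSat, Fm.Sat, not_forall, not_not]

section ZeroClosure

variable (f g : (ℕ → N) → N) (P Q : (ℕ → N) → Prop)

instance D0.eq [hf : IsTm f] [hg : IsTm g] : D0 M fun v => f v = g v :=
  let ⟨a, ha⟩ := hf.out
  let ⟨b, hb⟩ := hg.out
  ⟨.eq a b, fun v => by simp only [Fm.Sat, ha, hb]⟩

instance D0.lt [hf : IsTm f] [hg : IsTm g] : D0 M fun v => f v < g v :=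
  let ⟨a, ha⟩ := hf.out
  let ⟨b, hb⟩ := hg.out
  ⟨.lt a b, fun v => by simp only [Fm.Sat, ha, hb]⟩

instance D0.mem [hf : IsTm f] : D0 M fun v => f v ∈ M :=
  let ⟨a, ha⟩ := hf.out
  ⟨.mem a 0, fun v => by simp only [Fm.Sat, ha]⟩

instance D0.not [h : D0 M P] : D0 M fun v => ¬ P v :=
  let ⟨φ, hφ⟩ := h.out
  ⟨.neg φ, fun v => by simp only [Fm.Sat, hφ]⟩

instance D0.and [h : D0 M P] [h' : D0 M Q] : D0 M fun v => P v ∧ Q v :=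
  let ⟨φ, hφ⟩ := h.out
  let ⟨ψ, hψ⟩ := h'.out
  ⟨.and φ ψ, fun v => by simp only [Fm.Sat, hφ, hψ]⟩

theorem D0.congr {P Q : (ℕ → N) → Prop} (h : D0 M P) (e : ∀ v, Q v ↔ P v) : D0 M Q :=
  (funext fun v => propext (e v) : Q = P) ▸ h

instance D0.imp [D0 M P] [D0 M Q] : D0 M fun v => P v → Q v :=
  D0.congr (P := fun v => ¬ (P v ∧ ¬ Q v)) inferInstance fun v => by tauto

instance D0.or [D0 M P] [D0 M Q] : D0 M fun v => P v ∨ Q v :=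
  D0.congr (P := fun v => ¬ (¬ P v ∧ ¬ Q v)) inferInstance fun v => by tauto

/-- The quantified variable enters the hypothesis as `v 0` and the old assignment as the shift of
`v`, the de Bruijn form in which unification can strip quantifiers one at a time. -/
instance D0.ball (P : N → (ℕ → N) → Prop) [hf : IsTm f]
    [h : D0 M fun v => P (v 0) fun k => v (k + 1)] : D0 M fun v => ∀ x, x < f v → P x v :=
  let ⟨a, ha⟩ := hf.out
  let ⟨φ, hφ⟩ := h.out
  ⟨.ball a φ, fun v => by
    simp only [Fm.Sat, ha]
    exact forall₂_congr fun x _ => hφ (scons x v)⟩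

instance D0.bex (P : N → (ℕ → N) → Prop) [IsTm f]
    [D0 M fun v => P (v 0) fun k => v (k + 1)] : D0 M fun v => ∃ x, x < f v ∧ P x v :=
  D0.congr (P := fun v => ¬ ∀ x, x < f v → ¬ P x v) inferInstance fun v => by push Not; rfl

end ZeroClosure

theorem D0.comp {P : (ℕ → N) → Prop} (h : D0 M P) (s : ℕ → (ℕ → N) → N) (hs : ∀ k, IsTm (s k)) :
    D0 M fun v => P fun k => s k v := by
  obtain ⟨φ, hφ⟩ := h.out
  choose t ht using fun k => (hs k).out
  refine ⟨φ.subst t, fun v => ?_⟩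
  rw [hφ, Fm.sat_subst]
  simp only [ht]

theorem D0.rename {P P' : (ℕ → N) → Prop} (h : D0 M P) (r : ℕ → ℕ)
    (e : ∀ v, P' v ↔ P fun k => v (r k)) : D0 M P' :=
  (h.comp (fun k v => v (r k)) fun _ => inferInstance).congr e

theorem Sig.of_exists (P : N → (ℕ → N) → Prop) (h : D0 M fun v => P (v 0) fun k => v (k + 1)) :
    Sig M fun v => ∃ x, P x v :=
  let ⟨φ, hφ⟩ := h.out
  ⟨φ, fun v => exists_congr fun x => hφ (scons x v)⟩

theorem Sig.exists_D0 {P : (ℕ → N) → Prop} (h : Sig M P) :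
    ∃ Q : (ℕ → N) → Prop, D0 M Q ∧ ∀ v, P v ↔ ∃ x, Q (scons x v) :=
  let ⟨φ, hφ⟩ := h.out
  ⟨fun v => φ.Sat (fun _ => M) v, ⟨φ, fun _ => Iff.rfl⟩, hφ⟩

theorem Sig.congr {P Q : (ℕ → N) → Prop} (h : Sig M P) (e : ∀ v, Q v ↔ P v) : Sig M Q :=
  (funext fun v => propext (e v) : Q = P) ▸ h

theorem D0.sig {P : (ℕ → N) → Prop} (h : D0 M P) : Sig M P :=
  have : D0 M fun v => P fun k => v (k + 1) := h.rename _ fun _ => Iff.rfl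
  (Sig.of_exists (fun _ v => P v) this).congr fun v => by simp

end Definability

/-! ### The ordered semiring of a model of `RCA₀` -/

namespace RCA0

variable {N : Type*} [Zero N] [One N] [Add N] [Mul N] [LT N] {S : Set (Set N)}

theorem induction_sig (h : RCA0 S) {M : Set N} (hM : M ∈ S) {P : (ℕ → N) → Prop} (hP : Sig M P)
    (w : ℕ → N) (h0 : P (scons 0 w)) (hs : ∀ n, P (scons n w) → P (scons (n + 1) w)) (n : N) :
    P (scons n w) := by
  obtain ⟨φ, hφ⟩ := hP.out
  rw [hφ]
  refine h.sigma_induction φ w (fun _ => M) (fun _ => hM) ((hφ _).1 h0) (fun n hn => ?_) n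
  exact (hφ _).1 (hs n ((hφ _).2 hn))

/-- For purely arithmetical formulas: any member of `S` serves as a dummy set parameter. Variable 0
is the induction variable, and `w` lists the parameters. -/
theorem induction_D0 (h : RCA0 S) (P : (ℕ → N) → Prop) (hP : ∀ M : Set N, D0 M P)
    (w : ℕ → N) (h0 : P (scons 0 w)) (hs : ∀ n, P (scons n w) → P (scons (n + 1) w)) (n : N) :
    P (scons n w) :=
  let ⟨M, hM⟩ := h.sets_nonempty
  h.induction_sig hM (hP M).sig w h0 hs n


end RCA0
end SOA

namespace SOA
namespace RCA0

variable {N : Type*} [Zero N] [One N] [Add N] [Mul N] [LT N] {S : Set (Set N)}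

theorem zero_add (h : RCA0 S) (n : N) : 0 + n = n :=
  h.induction_D0 (fun v => 0 + v 0 = v 0) (fun _ => inferInstance) (fun _ => 0)
    (h.add_zero 0) (fun n (hn : 0 + n = n) => show 0 + (n + 1) = n + 1 by
      rw [h.add_add_one, hn]) n

theorem add_one_add (h : RCA0 S) (m n : N) : (m + 1) + n = (m + n) + 1 :=
  h.induction_D0 (fun v => (v 1 + 1) + v 0 = (v 1 + v 0) + 1) (fun _ => inferInstance)
    (fun _ => m) (show m + 1 + 0 = m + 0 + 1 by rw [h.add_zero, h.add_zero])
    (fun n (hn : m + 1 + n = m + n + 1) => show m + 1 + (n + 1) = m + (n + 1) + 1 by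
      rw [h.add_add_one, hn, h.add_add_one]) n

theorem add_comm (h : RCA0 S) (m n : N) : m + n = n + m :=
  h.induction_D0 (fun v => v 1 + v 0 = v 0 + v 1) (fun _ => inferInstance)
    (fun _ => m) (show m + 0 = 0 + m by rw [h.add_zero, h.zero_add])
    (fun n (hn : m + n = n + m) => show m + (n + 1) = n + 1 + m by
      rw [h.add_add_one, hn, h.add_one_add]) n

theorem add_assoc (h : RCA0 S) (a b c : N) : a + b + c = a + (b + c) :=
  h.induction_D0 (fun v => v 1 + v 2 + v 0 = v 1 + (v 2 + v 0)) (fun _ => inferInstance)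
    (scons a fun _ => b) (show a + b + 0 = a + (b + 0) by rw [h.add_zero, h.add_zero])
    (fun n (hn : a + b + n = a + (b + n)) => show a + b + (n + 1) = a + (b + (n + 1)) by
      rw [h.add_add_one, hn, h.add_add_one, h.add_add_one]) c

theorem zero_mul (h : RCA0 S) (n : N) : 0 * n = 0 :=
  h.induction_D0 (fun v => 0 * v 0 = 0) (fun _ => inferInstance) (fun _ => 0)
    (h.mul_zero 0) (fun n (hn : 0 * n = 0) => show 0 * (n + 1) = 0 by
      rw [h.mul_add_one, hn, h.add_zero]) n

theorem add_one_mul (h : RCA0 S) (m n : N) : (m + 1) * n = m * n + n :=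
  h.induction_D0 (fun v => (v 1 + 1) * v 0 = v 1 * v 0 + v 0) (fun _ => inferInstance)
    (fun _ => m) (show (m + 1) * 0 = m * 0 + 0 by rw [h.mul_zero, h.mul_zero, h.add_zero])
    (fun n (hn : (m + 1) * n = m * n + n) => show (m + 1) * (n + 1) = m * (n + 1) + (n + 1) by
      rw [h.mul_add_one, hn, h.mul_add_one, h.add_add_one, h.add_add_one, h.add_assoc _ n m,
        h.add_comm n m, ← h.add_assoc]) n

theorem mul_comm (h : RCA0 S) (m n : N) : m * n = n * m :=
  h.induction_D0 (fun v => v 1 * v 0 = v 0 * v 1) (fun _ => inferInstance)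
    (fun _ => m) (show m * 0 = 0 * m by rw [h.mul_zero, h.zero_mul])
    (fun n (hn : m * n = n * m) => show m * (n + 1) = (n + 1) * m by
      rw [h.mul_add_one, hn, h.add_one_mul]) n

theorem mul_add (h : RCA0 S) (a b c : N) : a * (b + c) = a * b + a * c :=
  h.induction_D0 (fun v => v 1 * (v 2 + v 0) = v 1 * v 2 + v 1 * v 0) (fun _ => inferInstance)
    (scons a fun _ => b)
    (show a * (b + 0) = a * b + a * 0 by rw [h.add_zero, h.mul_zero, h.add_zero])
    (fun n (hn : a * (b + n) = a * b + a * n) =>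
      show a * (b + (n + 1)) = a * b + a * (n + 1) by
      rw [h.add_add_one, h.mul_add_one, hn, h.mul_add_one, h.add_assoc]) c

theorem mul_assoc (h : RCA0 S) (a b c : N) : a * b * c = a * (b * c) :=
  h.induction_D0 (fun v => v 1 * v 2 * v 0 = v 1 * (v 2 * v 0)) (fun _ => inferInstance)
    (scons a fun _ => b)
    (show a * b * 0 = a * (b * 0) by rw [h.mul_zero, h.mul_zero, h.mul_zero])
    (fun n (hn : a * b * n = a * (b * n)) => show a * b * (n + 1) = a * (b * (n + 1)) by
      rw [h.mul_add_one, h.mul_add_one, hn, h.mul_add]) c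

theorem mul_one (h : RCA0 S) (n : N) : n * 1 = n := by
  rw [← h.zero_add 1, h.mul_add_one, h.mul_zero, h.zero_add]

/-- The semiring of numbers of a model of `RCA₀`. -/
abbrev commSemiring (h : RCA0 S) : CommSemiring N where
  add_assoc := h.add_assoc
  zero_add := h.zero_add
  add_zero := h.add_zero
  add_comm := h.add_comm
  left_distrib := h.mul_add
  right_distrib a b c := by rw [h.mul_comm, h.mul_add, h.mul_comm c, h.mul_comm c]
  zero_mul := h.zero_mul
  mul_zero := h.mul_zero
  mul_assoc := h.mul_assoc
  one_mul n := by rw [h.mul_comm, h.mul_one]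
  mul_one := h.mul_one
  mul_comm := h.mul_comm
  nsmul := nsmulRec
  npow := @npowRec N ⟨1⟩ _

/-! ### The linear order and its compatibility with the operations. -/

theorem lt_trans (h : RCA0 S) {a b c : N} (hab : a < b) (hbc : b < c) : a < c :=
  h.induction_D0 (fun v => v 2 < v 0 → v 1 < v 0) (fun _ => inferInstance) (scons a fun _ => b)
    (fun h0 => (h.not_lt_zero _ h0).elim)
    (fun n (hn : b < n → a < n) (hb : b < n + 1) => show a < n + 1 from
      (h.lt_add_one_iff _ _).2 <| Or.inl <|
        ((h.lt_add_one_iff _ _).1 hb).elim hn fun e => e ▸ hab) c hbc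

theorem lt_add_one (h : RCA0 S) (n : N) : n < n + 1 := (h.lt_add_one_iff _ _).2 (.inr rfl)

theorem lt_irrefl (h : RCA0 S) (n : N) : ¬ n < n :=
  h.induction_D0 (fun v => ¬ v 0 < v 0) (fun _ => inferInstance) (fun _ => 0) (h.not_lt_zero 0)
    (fun n (hn : ¬ n < n) (hs : n + 1 < n + 1) => hn <|
      ((h.lt_add_one_iff _ _).1 hs).elim (fun h' => h.lt_trans (h.lt_add_one n) h')
        fun e => e ▸ (h.lt_add_one n).trans_eq e) n

theorem add_one_le (h : RCA0 S) {a b : N} (hab : a < b) : a + 1 < b ∨ a + 1 = b :=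
  h.induction_D0 (fun v => v 1 < v 0 → v 1 + 1 < v 0 ∨ v 1 + 1 = v 0) (fun _ => inferInstance)
    (fun _ => a) (fun h0 => (h.not_lt_zero _ h0).elim)
    (fun n (hn : a < n → a + 1 < n ∨ a + 1 = n) (ha : a < n + 1) =>
      show a + 1 < n + 1 ∨ a + 1 = n + 1 from
      ((h.lt_add_one_iff _ _).1 ha).elim (fun h' => .inl ((h.lt_add_one_iff _ _).2 (hn h')))
        fun e => .inr (e ▸ rfl)) b hab

theorem zero_le (h : RCA0 S) (n : N) : 0 < n ∨ 0 = n :=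
  h.induction_D0 (fun v => 0 < v 0 ∨ 0 = v 0) (fun _ => inferInstance) (fun _ => 0)
    (.inr rfl) (fun _ hn => .inl ((h.lt_add_one_iff _ _).2 hn)) n

theorem lt_trichotomy (h : RCA0 S) (a b : N) : a < b ∨ a = b ∨ b < a :=
  h.induction_D0 (fun v => v 0 < v 1 ∨ v 0 = v 1 ∨ v 1 < v 0) (fun _ => inferInstance)
    (fun _ => b) ((h.zero_le b).imp_right .inl)
    (fun n (hn : n < b ∨ n = b ∨ b < n) => show n + 1 < b ∨ n + 1 = b ∨ b < n + 1 by
      rcases hn with hn | hn | hn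
      · exact (h.add_one_le hn).imp_right .inl
      · exact .inr (.inr ((h.lt_add_one_iff _ _).2 (.inr hn.symm)))
      · exact .inr (.inr ((h.lt_add_one_iff _ _).2 (.inl hn)))) a

/-- The linear order of the numbers of a model of `RCA₀`. -/
noncomputable abbrev linearOrder (h : RCA0 S) : LinearOrder N where
  le a b := a < b ∨ a = b
  lt a b := a < b
  le_refl _ := .inr rfl
  le_trans a b c := by
    rintro (h1 | rfl) (h2 | rfl)
    exacts [.inl (h.lt_trans h1 h2), .inl h1, .inl h2, .inr rfl]
  lt_iff_le_not_ge a b :=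
    ⟨fun h1 => ⟨.inl h1, fun h2 => h2.elim (fun h2 => h.lt_irrefl _ (h.lt_trans h1 h2))
      fun e => h.lt_irrefl a (e ▸ h1)⟩, fun h1 => h1.1.resolve_right fun e => h1.2 (.inr e.symm)⟩
  le_antisymm a b := by
    rintro (h1 | h1) (h2 | h2)
    exacts [(h.lt_irrefl _ (h.lt_trans h1 h2)).elim, h2.symm, h1, h1]
  le_total a b := by rcases h.lt_trichotomy a b with h1 | h1 | h1 <;> simp [h1]
  toDecidableLE := Classical.decRel _

theorem add_lt_add_right (h : RCA0 S) {a b : N} (hab : a < b) (c : N) : a + c < b + c :=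
  h.induction_D0 (fun v => v 1 + v 0 < v 2 + v 0) (fun _ => inferInstance) (scons a fun _ => b)
    (show a + 0 < b + 0 by rwa [h.add_zero, h.add_zero])
    (fun n (hn : a + n < b + n) => show a + (n + 1) < b + (n + 1) by
      rw [h.add_add_one, h.add_add_one]
      exact (h.lt_add_one_iff _ _).2 (h.add_one_le hn)) c

theorem exists_add_one_of_lt (h : RCA0 S) {a b : N} (hab : a < b) : ∃ c, b = a + (c + 1) := by
  obtain ⟨M, hM⟩ := h.sets_nonempty
  -- The implication sits under the quantifier, so that the matrix is Σ⁰₀ and the formula Σ⁰₁.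
  refine h.induction_sig hM (P := fun v => ∃ c, v 1 < v 0 → v 0 = v 1 + (c + 1))
    (Sig.of_exists (fun c v => v 1 < v 0 → v 0 = v 1 + (c + 1)) inferInstance) (fun _ => a)
    ⟨0, fun h0 => (h.not_lt_zero _ h0).elim⟩ ?_ b |>.imp fun c hc => hc hab
  rintro n ⟨c, hc : a < n → n = a + (c + 1)⟩
  show ∃ c, a < n + 1 → n + 1 = a + (c + 1)
  rcases h.lt_trichotomy a n with h1 | rfl | h1
  · exact ⟨c + 1, fun _ => by rw [h.add_add_one, ← hc h1]⟩
  · exact ⟨0, fun _ => by rw [h.zero_add]⟩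
  · refine ⟨0, fun h2 => ?_⟩
    rcases (h.lt_add_one_iff _ _).1 h2 with h2 | rfl
    · exact (h.lt_irrefl _ (h.lt_trans h1 h2)).elim
    · exact (h.lt_irrefl _ h1).elim

theorem le_self_add (h : RCA0 S) (a b : N) : a < a + b ∨ a = a + b := by
  rcases h.zero_le b with hb | rfl
  · have := h.add_lt_add_right hb a
    rw [h.zero_add, h.add_comm] at this
    exact .inl this
  · exact .inr (h.add_zero a).symm

theorem mul_lt_mul_left (h : RCA0 S) {a b c : N} (ha : 0 < a) (hbc : b < c) :
    a * b < a * c := by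
  obtain ⟨d, rfl⟩ := h.exists_add_one_of_lt hbc
  have h1 : a * b + 0 < a * b + a := by
    rw [h.add_comm _ 0, h.add_comm _ a]
    exact h.add_lt_add_right ha _
  rw [h.mul_add, h.mul_add_one, h.add_comm (a * d), ← h.add_assoc]
  rw [h.add_zero] at h1
  rcases h.le_self_add (a * b + a) (a * d) with h2 | h2
  · exact h.lt_trans h1 h2
  · rwa [← h2]

end RCA0

/-- A discretely ordered semiring. -/
class DiscreteSemiring (N : Type*) extends CommSemiring N, LinearOrder N, IsStrictOrderedRing N,
    CanonicallyOrderedAdd N where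
  lt_add_one_iff_le : ∀ a b : N, a < b + 1 ↔ a ≤ b

/-- The discretely ordered semiring of numbers of a model of `RCA₀`. -/
noncomputable abbrev RCA0.discreteSemiring {N : Type*} [Zero N] [One N] [Add N] [Mul N] [LT N]
    {S : Set (Set N)} (h : RCA0 S) : DiscreteSemiring N :=
  { h.commSemiring, h.linearOrder with
    add_le_add_left := fun a b hab c => by
      rcases hab with hab | rfl
      · exact .inl (h.add_lt_add_right hab c)
      · exact .inr rfl
    le_of_add_le_add_left := fun a b c hbc => by
      rcases h.lt_trichotomy b c with h1 | h1 | h1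
      · exact .inl h1
      · exact .inr h1
      · have h2 := h.add_lt_add_right h1 a
        rw [h.add_comm c, h.add_comm b] at h2
        rcases hbc with h3 | h3
        · exact (h.lt_irrefl _ (h.lt_trans h2 h3)).elim
        · exact (h.lt_irrefl (a + b) (h3 ▸ h2)).elim
    zero_le_one := h.zero_le 1
    exists_pair_ne := ⟨0, 1, fun e => h.add_one_ne_zero 0 (by rw [h.zero_add, e])⟩
    mul_lt_mul_of_pos_left := fun a ha b c hbc => h.mul_lt_mul_left ha hbc
    mul_lt_mul_of_pos_right := fun a ha b c hbc => by
      show b * a < c * a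
      rw [h.mul_comm b, h.mul_comm c]
      exact h.mul_lt_mul_left ha hbc
    exists_add_of_le := fun {a b} hab => by
      rcases hab with hab | rfl
      · exact (h.exists_add_one_of_lt hab).imp' (· + 1) fun _ => id
      · exact ⟨0, (h.add_zero _).symm⟩
    le_self_add := fun a b => h.le_self_add a b
    le_add_self := fun a b => by rw [h.add_comm]; exact h.le_self_add a b
    lt_add_one_iff_le := h.lt_add_one_iff }

/-! ### Closure properties of `Σ⁰₁` and `Π⁰₁` -/

theorem scons_eq {N : Type*} {r : ℕ → ℕ} {v w : ℕ → N} {a : N} (h0 : v (r 0) = a)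
    (h : ∀ k, v (r (k + 1)) = w k) : scons a w = fun k => v (r k) := by
  funext k
  cases k
  exacts [h0.symm, (h _).symm]

theorem scons_scons_eq {N : Type*} {r : ℕ → ℕ} {v w : ℕ → N} {a b : N} (h0 : v (r 0) = a)
    (h1 : v (r 1) = b) (h : ∀ k, v (r (k + 2)) = w k) :
    scons a (scons b w) = fun k => v (r k) :=
  scons_eq h0 fun k => by cases k; exacts [h1, h _]

/-- `Σ⁰₁` induction with the set parameter `M`. -/
class SigmaInduction {N : Type*} [DiscreteSemiring N] (M : Set N) : Prop where
  induction : ∀ P : (ℕ → N) → Prop, Sig M P → ∀ w : ℕ → N, P (scons 0 w) →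
    (∀ n, P (scons n w) → P (scons (n + 1) w)) → ∀ n, P (scons n w)

section Closure

variable {N : Type*} [DiscreteSemiring N] {M : Set N}

theorem lt_add_one_iff {a b : N} : a < b + 1 ↔ a ≤ b := DiscreteSemiring.lt_add_one_iff_le a b

theorem add_one_le_iff {a b : N} : a + 1 ≤ b ↔ a < b := by
  rw [← not_lt, lt_add_one_iff, not_le]

theorem leq_iff {a b : N} : Leq a b ↔ a ≤ b := le_iff_lt_or_eq.symm

variable (f g : (ℕ → N) → N) (P Q : (ℕ → N) → Prop)

instance Sig.eq [IsTm f] [IsTm g] : Sig M fun v => f v = g v := D0.sig inferInstance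
instance Sig.lt [IsTm f] [IsTm g] : Sig M fun v => f v < g v := D0.sig inferInstance
instance Sig.mem [IsTm f] : Sig M fun v => f v ∈ M := D0.sig inferInstance
instance Pi.eq [IsTm f] [IsTm g] : Pi M fun v => f v = g v := ⟨D0.sig inferInstance⟩
instance Pi.lt [IsTm f] [IsTm g] : Pi M fun v => f v < g v := ⟨D0.sig inferInstance⟩
instance Pi.mem [IsTm f] : Pi M fun v => f v ∈ M := ⟨D0.sig inferInstance⟩

instance Sig.le [IsTm f] [IsTm g] : Sig M fun v => f v ≤ g v :=
  Sig.congr (P := fun v => f v < g v + 1) inferInstance fun _ => lt_add_one_iff.symm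

theorem Pi.congr {P Q : (ℕ → N) → Prop} (h : Pi M P) (e : ∀ v, Q v ↔ P v) : Pi M Q :=
  (funext fun v => propext (e v) : Q = P) ▸ h

instance Pi.le [IsTm f] [IsTm g] : Pi M fun v => f v ≤ g v :=
  Pi.congr (P := fun v => f v < g v + 1) inferInstance fun _ => lt_add_one_iff.symm

instance Sig.not [h : Pi M P] : Sig M fun v => ¬ P v := h.out
instance Pi.not [h : Sig M P] : Pi M fun v => ¬ P v := ⟨h.congr fun _ => not_not⟩

instance Sig.ex (P : N → (ℕ → N) → Prop) [h : Sig M fun v => P (v 0) fun k => v (k + 1)] :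
    Sig M fun v => ∃ x, P x v := by
  obtain ⟨Q, hQ, e⟩ := h.exists_D0
  have : D0 M fun v => Q (scons (v 0) (scons (v 1) fun k => v (k + 1 + 1 + 1))) :=
    hQ.rename (fun | 0 => 0 | 1 => 1 | k + 2 => k + 3) fun v => by
      rw [scons_scons_eq] <;> intros <;> rfl
  -- Two unbounded quantifiers become one by letting `z` bound both witnesses.
  refine (Sig.of_exists
    (fun z v => ∃ x, x < z ∧ ∃ y, y < z ∧ Q (scons y (scons x v))) inferInstance).congr fun v => ?_
  refine ⟨fun ⟨x, hx⟩ => ?_, fun ⟨z, x, _, y, _, h⟩ => ⟨x, (e (scons x v)).2 ⟨y, h⟩⟩⟩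
  obtain ⟨y, hy⟩ := (e (scons x v)).1 hx
  exact ⟨max x y + 1, x, by simp [lt_add_one_iff], y, by simp [lt_add_one_iff], hy⟩

instance Sig.or [h : Sig M P] [h' : Sig M Q] : Sig M fun v => P v ∨ Q v := by
  obtain ⟨A, hA, eA⟩ := h.exists_D0
  obtain ⟨B, hB, eB⟩ := h'.exists_D0
  have e (v : ℕ → N) : (scons (v 0) fun k => v (k + 1)) = v := by funext k; cases k <;> rfl
  refine (Sig.of_exists (fun x v => A (scons x v) ∨ B (scons x v)) ?_).congr fun v => ?_
  · simp only [e]; infer_instance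
  · simp only [eA, eB, exists_or]

instance Sig.and [h : Sig M P] [h' : Sig M Q] : Sig M fun v => P v ∧ Q v := by
  obtain ⟨A, hA, eA⟩ := h.exists_D0
  obtain ⟨B, hB, eB⟩ := h'.exists_D0
  have hA' : D0 M fun v => A (scons (v 0) fun k => v (k + 1 + 1)) :=
    hA.rename (fun | 0 => 0 | k + 1 => k + 2) fun v => by rw [scons_eq] <;> intros <;> rfl
  have hB' : D0 M fun v => B (scons (v 0) fun k => v (k + 1 + 1)) :=
    hB.rename (fun | 0 => 0 | k + 1 => k + 2) fun v => by rw [scons_eq] <;> intros <;> rfl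
  refine (Sig.of_exists (fun z v => (∃ x, x < z ∧ A (scons x v)) ∧ ∃ y, y < z ∧ B (scons y v))
    inferInstance).congr fun v => ?_
  rw [eA, eB]
  refine ⟨fun ⟨⟨x, hx⟩, y, hy⟩ => ⟨max x y + 1, ?_, ?_⟩,
    fun ⟨_, ⟨x, _, hx⟩, y, _, hy⟩ => ⟨⟨x, hx⟩, y, hy⟩⟩
  exacts [⟨x, by simp [lt_add_one_iff], hx⟩, ⟨y, by simp [lt_add_one_iff], hy⟩]

instance Sig.imp [Pi M P] [Sig M Q] : Sig M fun v => P v → Q v :=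
  Sig.congr (P := fun v => ¬ P v ∨ Q v) inferInstance fun v => by tauto

instance Pi.and [h : Pi M P] [h' : Pi M Q] : Pi M fun v => P v ∧ Q v :=
  ⟨Sig.congr (P := fun v => ¬ P v ∨ ¬ Q v) inferInstance fun v => by tauto⟩

instance Pi.or [h : Pi M P] [h' : Pi M Q] : Pi M fun v => P v ∨ Q v :=
  ⟨Sig.congr (P := fun v => ¬ P v ∧ ¬ Q v) inferInstance fun v => by tauto⟩

instance Pi.imp [h : Sig M P] [h' : Pi M Q] : Pi M fun v => P v → Q v :=
  ⟨Sig.congr (P := fun v => P v ∧ ¬ Q v) inferInstance fun v => by tauto⟩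

instance Pi.all (P : N → (ℕ → N) → Prop) [h : Pi M fun v => P (v 0) fun k => v (k + 1)] :
    Pi M fun v => ∀ x, P x v :=
  ⟨Sig.congr (P := fun v => ∃ x, ¬ P x v) inferInstance fun v => by push Not; rfl⟩

instance Sig.iff [Sig M P] [Sig M Q] [Pi M P] [Pi M Q] : Sig M fun v => P v ↔ Q v :=
  Sig.congr (P := fun v => (P v → Q v) ∧ (Q v → P v)) inferInstance fun v => by tauto

instance Pi.iff [Sig M P] [Sig M Q] [Pi M P] [Pi M Q] : Pi M fun v => P v ↔ Q v :=
  Pi.congr (P := fun v => (P v → Q v) ∧ (Q v → P v)) inferInstance fun v => by tauto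

/-- This is Σ⁰₁ bounding, derived from Σ⁰₁ induction: by induction on `n`, a single `z` bounds
witnesses for all x < n below `f v`, and then the unbounded quantifier can be moved to the front. -/
instance Sig.ball [SigmaInduction M] (P : N → (ℕ → N) → Prop) [IsTm f]
    [h : Sig M fun v => P (v 0) fun k => v (k + 1)] : Sig M fun v => ∀ x, x < f v → P x v := by
  obtain ⟨Q, hQ, e⟩ := h.exists_D0
  have : D0 M fun v => Q (scons (v 0) (scons (v 1) fun k => v (k + 1 + 1 + 1))) :=
    hQ.rename (fun | 0 => 0 | 1 => 1 | k + 2 => k + 3) fun v => by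
      rw [scons_scons_eq] <;> intros <;> rfl
  have : IsTm fun v : ℕ → N => f fun k => v (k + 1) := IsTm.tail inferInstance
  refine (Sig.of_exists (fun z v => ∀ x, x < f v → ∃ y, y < z ∧ Q (scons y (scons x v)))
    inferInstance).congr fun v => ?_
  refine ⟨fun hx => ?_, fun ⟨z, h⟩ x hx =>
    (e (scons x v)).2 ((h x hx).imp fun _ h => h.2)⟩
  have : D0 M fun v => Q (scons (v 0) (scons (v 1) fun k => v (k + 1 + 1 + 1 + 1))) :=
    hQ.rename (fun | 0 => 0 | 1 => 1 | k + 2 => k + 4) fun v => by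
      rw [scons_scons_eq] <;> intros <;> rfl
  have : IsTm fun v : ℕ → N => f fun k => v (k + 1 + 1) := IsTm.tail ‹_›
  have : IsTm fun v : ℕ → N => f fun k => v (k + 1 + 1 + 1) := IsTm.tail ‹_›
  have key := SigmaInduction.induction (M := M)
    (fun v => ∃ z, ∀ x, x < v 0 → x < f (fun k => v (k + 1)) →
      ∃ y, y < z ∧ Q (scons y (scons x fun k => v (k + 1))))
    (Sig.of_exists (fun z v => ∀ x, x < v 0 → x < f (fun k => v (k + 1)) →
      ∃ y, y < z ∧ Q (scons y (scons x fun k => v (k + 1)))) inferInstance) v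
    ⟨0, fun x h0 => (not_lt_zero h0).elim⟩ ?_ (f v)
  · exact key.imp fun z hz x hx => hz x hx hx
  rintro n ⟨z, hz : ∀ x, x < n → x < f v → ∃ y, y < z ∧ Q (scons y (scons x v))⟩
  show ∃ z, ∀ x, x < n + 1 → x < f v → ∃ y, y < z ∧ Q (scons y (scons x v))
  by_cases hn : n < f v
  · obtain ⟨y, hy⟩ := (e (scons n v)).1 (hx n hn)
    refine ⟨max z (y + 1), fun x h1 h2 => ?_⟩
    rcases (lt_add_one_iff.1 h1).lt_or_eq with h1 | rfl
    · exact (hz x h1 h2).imp fun w hw => ⟨lt_max_of_lt_left hw.1, hw.2⟩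
    · exact ⟨y, by simp, hy⟩
  · exact ⟨z, fun x h1 h2 => hz x (by grind [lt_add_one_iff]) h2⟩

instance Pi.bex [SigmaInduction M] (P : N → (ℕ → N) → Prop) [IsTm f]
    [h : Pi M fun v => P (v 0) fun k => v (k + 1)] : Pi M fun v => ∃ x, x < f v ∧ P x v :=
  ⟨Sig.congr (P := fun v => ∀ x, x < f v → ¬ P x v) inferInstance fun v => by push Not; rfl⟩

end Closure
/-! ### Pairs and binary strings -/

section Strings

variable {N : Type*} [DiscreteSemiring N] {M : Set N}

theorem Sig.comp {P : (ℕ → N) → Prop} (h : Sig M P) (s : ℕ → (ℕ → N) → N)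
    (hs : ∀ k, IsTm (s k)) : Sig M fun v => P fun k => s k v := by
  obtain ⟨φ, hφ⟩ := h.out
  choose t ht using fun k => (hs k).out
  refine ⟨φ.subst (liftSubst t), fun v => ?_⟩
  simp only [hφ, SigmaSat, Fm.sat_subst, val_liftSubst, ht]

theorem Sig.comp₂ {R : N → N → Prop} (h : Sig M fun v => R (v 0) (v 1)) (f g : (ℕ → N) → N)
    [IsTm f] [IsTm g] : Sig M fun v => R (f v) (g v) :=
  h.comp (fun | 0 => f | _ => g) fun k => by rcases k with _ | k <;> assumption

theorem Sig.comp₃ {R : N → N → N → Prop} (h : Sig M fun v => R (v 0) (v 1) (v 2))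
    (f g e : (ℕ → N) → N) [IsTm f] [IsTm g] [IsTm e] : Sig M fun v => R (f v) (g v) (e v) :=
  h.comp (fun | 0 => f | 1 => g | _ => e) fun k => by rcases k with _ | _ | k <;> assumption

theorem Pi.comp₂ {R : N → N → Prop} (h : Pi M fun v => R (v 0) (v 1)) (f g : (ℕ → N) → N)
    [IsTm f] [IsTm g] : Pi M fun v => R (f v) (g v) :=
  ⟨Sig.comp₂ (R := fun a b => ¬ R a b) h.out f g⟩

/-- If there were no least element, the Σ⁰₁ statement that nothing below `n` satisfies `A` would be
inductive. -/
theorem exists_least [SigmaInduction M] {A : (ℕ → N) → Prop} (hA : Pi M A) (w : ℕ → N)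
    (h : ∃ n, A (scons n w)) : ∃ n, A (scons n w) ∧ ∀ m, m < n → ¬ A (scons m w) := by
  by_contra! H
  obtain ⟨n, hn⟩ := h
  have h1 : Pi M fun v => A (scons (v 0) fun k => v (k + 1 + 1)) :=
    ⟨(hA.out.comp (fun | 0 => fun v => v 0 | k + 1 => fun v => v (k + 2)) fun k => by
      cases k <;> infer_instance).congr fun v => by
        rw [scons_eq (r := fun | 0 => 0 | k + 1 => k + 2)]
        · refine not_congr (iff_of_eq (congrArg A ?_))
          funext k; cases k <;> rfl
        · rfl
        · intros; rfl⟩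
  have := SigmaInduction.induction (M := M)
    (fun v => ∀ x, x < v 0 → ¬ A (scons x fun k => v (k + 1))) inferInstance w
    (fun x h0 => (not_lt_zero h0).elim)
    (fun n (hn : ∀ x, x < n → ¬ A (scons x w)) x (hx : x < n + 1) => by
      rcases (lt_add_one_iff.1 hx).lt_or_eq with h | rfl
      · exact hn x h
      · intro hx
        obtain ⟨m, hm, hm'⟩ := H x hx
        exact hn m hm hm') (n + 1) n (lt_add_one_iff.2 le_rfl)
  exact this hn

theorem le_mul_self (a : N) : a ≤ a * a := by
  rcases eq_zero_or_pos a with rfl | h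
  · simp
  · exact le_mul_of_one_le_right' (by simpa using add_one_le_iff.2 h)

theorem le_pair_left (i j : N) : i ≤ pair i j := le_add_self

theorem le_pair_right (i j : N) : j ≤ pair i j :=
  (le_add_self.trans (le_mul_self (i + j))).trans le_self_add

theorem pair_le_pair {i j i' j' : N} (hi : i ≤ i') (hj : j ≤ j') : pair i j ≤ pair i' j' := by
  unfold pair; gcongr

/-- With s = i + j the code lies in the interval [s², (s+1)²), and these intervals are disjoint for
different s. -/
theorem add_eq_of_pair_eq {i j i' j' : N} (h : pair i j = pair i' j') : i' + j' ≤ i + j := by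
  by_contra! hlt
  have h1 := add_one_le_iff.2 hlt
  have h2 : (i + j + 1) * (i + j + 1) ≤ (i' + j') * (i' + j') := by gcongr
  have h3 : i ≤ i + j := le_self_add
  have h4 : 0 ≤ i' := zero_le
  have h5 : 0 ≤ i + j := zero_le
  have h6 : (0 : N) < 1 := zero_lt_one
  unfold pair at h
  generalize i + j = s at *
  generalize i' + j' = t at *
  have : (s + 1) * (s + 1) = s * s + s + s + 1 := by ring
  grind

theorem pair_inj {i j i' j' : N} : pair i j = pair i' j' ↔ i = i' ∧ j = j' := by
  refine ⟨fun h => ?_, by rintro ⟨rfl, rfl⟩; rfl⟩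
  have e := le_antisymm (add_eq_of_pair_eq h.symm) (add_eq_of_pair_eq h)
  unfold pair at h
  rw [e] at h
  have := add_left_cancel h
  subst this
  exact ⟨rfl, add_left_cancel e⟩

theorem dvd_iff_exists_le {a b : N} : a ∣ b ↔ ∃ d, d < b + 1 ∧ b = a * d := by
  refine ⟨?_, fun ⟨d, _, h⟩ => ⟨d, h⟩⟩
  rintro ⟨d, rfl⟩
  rcases eq_zero_or_pos a with rfl | h
  · exact ⟨0, by simp⟩
  · exact ⟨d, lt_add_one_iff.2 (le_mul_of_one_le_left' (by simpa using add_one_le_iff.2 h)), rfl⟩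

variable [SigmaInduction M] (f g : (ℕ → N) → N) [IsTm f] [IsTm g]

instance : Pi M fun v => f v ∣ g v :=
  Pi.comp₂ (R := (· ∣ ·)) (by simp only [dvd_iff_exists_le]; infer_instance) f g

/-- The definition is visibly Σ⁰₁. Bounding its quantifiers by the code makes it Π⁰₁ as well, as is
needed where it occurs negatively in `IsString`. -/
theorem hasLen_iff {p l : N} :
    HasLen p l ↔ ∃ m, m < p + 1 ∧ ∃ n, n < p + 1 ∧ p = pair (pair l m) n := by
  refine ⟨?_, fun ⟨m, _, n, _, h⟩ => ⟨m, n, h⟩⟩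
  rintro ⟨m, n, rfl⟩
  exact ⟨m, lt_add_one_iff.2 ((le_pair_right _ _).trans (le_pair_left _ _)), n,
    lt_add_one_iff.2 (le_pair_right _ _), rfl⟩

theorem bitOne_iff {p x : N} :
    BitOne p x ↔ ∃ l, l < p + 1 ∧ ∃ m, m < p + 1 ∧ ∃ n, n < p + 1 ∧ p = pair (pair l m) n ∧
      x < l ∧ (m * (x + 1) + 1) ∣ n := by
  refine ⟨?_, fun ⟨l, _, m, _, n, _, h⟩ => ⟨l, m, n, h⟩⟩
  rintro ⟨l, m, n, rfl, h⟩
  exact ⟨l, lt_add_one_iff.2 ((le_pair_left _ _).trans (le_pair_left _ _)),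
    m, lt_add_one_iff.2 ((le_pair_right _ _).trans (le_pair_left _ _)), n,
    lt_add_one_iff.2 (le_pair_right _ _), rfl, h⟩

instance : Sig M fun v => HasLen (f v) (g v) :=
  Sig.comp₂ (R := HasLen) (by unfold HasLen; infer_instance) f g

instance : Pi M fun v => HasLen (f v) (g v) :=
  Pi.comp₂ (R := HasLen) (by simp only [hasLen_iff]; infer_instance) f g

instance : Sig M fun v => BitOne (f v) (g v) :=
  Sig.comp₂ (R := BitOne) (by unfold BitOne; infer_instance) f g

instance : Pi M fun v => BitOne (f v) (g v) :=
  Pi.comp₂ (R := BitOne) (by simp only [bitOne_iff]; infer_instance) f g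

instance : Sig M fun v => IsString (f v) (g v) :=
  Sig.comp₂ (R := IsString) (by unfold IsString; infer_instance) f g

instance (e : (ℕ → N) → N) [IsTm e] : Sig M fun v => StringVal (f v) (g v) (e v) := by
  unfold StringVal; infer_instance

instance (e : (ℕ → N) → N) [IsTm e] : Pi M fun v => StringVal (f v) (g v) (e v) := by
  unfold StringVal; infer_instance

instance (e : (ℕ → N) → N) [IsTm e] : Sig M fun v => IsAppend (f v) (g v) (e v) :=
  Sig.comp₃ (R := IsAppend) (by unfold IsAppend; infer_instance) f g e

end Strings
-- Existence and boundedness of string codes.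
section StringExistence

variable {N : Type*} [DiscreteSemiring N]

theorem bitOne_pair {l m n x : N} :
    BitOne (pair (pair l m) n) x ↔ x < l ∧ (m * (x + 1) + 1) ∣ n := by
  refine ⟨?_, fun h => ⟨l, m, n, rfl, h⟩⟩
  rintro ⟨l', m', n', h, h'⟩
  rw [pair_inj, pair_inj] at h
  obtain ⟨⟨rfl, rfl⟩, rfl⟩ := h
  exact h'

theorem HasLen.unique {p l l' : N} (h : HasLen p l) (h' : HasLen p l') : l = l' := by
  obtain ⟨m, n, rfl⟩ := h
  obtain ⟨m', n', h⟩ := h'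
  exact (pair_inj.1 (pair_inj.1 h).1).1

/-- Of two distinct codes the larger would violate its minimality. -/
theorem IsString.ext {σ τ l : N} (hσ : IsString σ l) (hτ : IsString τ l)
    (h : ∀ x, x < l → (BitOne σ x ↔ BitOne τ x)) : σ = τ := by
  rcases lt_trichotomy σ τ with h1 | h1 | h1
  · obtain ⟨x, hx, hn⟩ := hτ.2 σ h1 hσ.1
    exact (hn (h x hx)).elim
  · exact h1
  · obtain ⟨x, hx, hn⟩ := hσ.2 τ h1 hτ.1
    exact (hn (h x hx).symm).elim

theorem HasLen.lt_of_bitOne {p l x : N} (h : HasLen p l) (hx : BitOne p x) : x < l := by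
  obtain ⟨m, n, rfl⟩ := h
  exact (bitOne_pair.1 hx).1

theorem dvd_of_dvd_add {a u w : N} (h : a ∣ u + w) (hu : a ∣ u) : a ∣ w := by
  obtain ⟨p, hp⟩ := h
  obtain ⟨q, rfl⟩ := hu
  rcases le_total p q with hpq | hpq
  · have h1 : a * q + w ≤ a * q + 0 := by rw [hp, add_zero]; gcongr
    rw [nonpos_iff_eq_zero.1 (le_of_add_le_add_left h1)]
    exact dvd_zero a
  · obtain ⟨r, rfl⟩ := exists_add_of_le hpq
    rw [mul_add] at hp
    exact ⟨r, add_left_cancel hp⟩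

/-- The β-function moduli are pairwise coprime, here without gcds or subtraction. A combination of
the moduli at x and k equals the distance d = |x − k|, so the modulus at x divides b·d. As d divides
m, it divides b·m·(x + 1), and therefore b. -/
theorem dvd_of_dvd_mul_of_ne {l m b x k : N} (hm : ∀ j, j < l → j + 1 ∣ m) (hx : x < l)
    (hk : k < l) (hxk : x ≠ k) (h : m * (x + 1) + 1 ∣ b * (m * (k + 1) + 1)) :
    m * (x + 1) + 1 ∣ b := by
  obtain ⟨d, hd, h1⟩ : ∃ d, d ∣ m ∧ m * (x + 1) + 1 ∣ b * d := by
    have key {d : N} (hd : d + 1 ≤ l) : d + 1 ∣ m := hm d (add_one_le_iff.1 hd)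
    rcases lt_or_gt_of_ne hxk with hlt | hlt
    · obtain ⟨d, rfl⟩ := exists_add_of_le (add_one_le_iff.2 hlt)
      refine ⟨d + 1, key (add_one_le_iff.2 (lt_of_le_of_lt ?_ hk)), ?_⟩
      · rw [add_right_comm]; exact le_add_self.trans (by rw [add_right_comm])
      · refine dvd_of_dvd_add (u := b * (m * (x + 1 + d + 1) + 1) * (x + 1)) ?_ (h.mul_right _)
        exact ⟨b * (x + 1 + d + 1), by ring⟩
    · obtain ⟨d, rfl⟩ := exists_add_of_le (add_one_le_iff.2 hlt)
      refine ⟨d + 1, key (add_one_le_iff.2 (lt_of_le_of_lt ?_ hx)), ?_⟩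
      · rw [add_right_comm]; exact le_add_self.trans (by rw [add_right_comm])
      · refine dvd_of_dvd_add (u := b * (k + 1) * (m * (k + 1 + d + 1) + 1)) ?_ (dvd_mul_left _ _)
        have := h.mul_right (k + 1 + d + 1)
        convert this using 1
        ring
  obtain ⟨e, rfl⟩ := hd
  refine dvd_of_dvd_add (u := b * d * (e * (x + 1))) ⟨b, by ring⟩ (h1.mul_right _)

/-- Such an `m` replaces the factorial of `l`. -/
theorem exists_pos_forall_add_one_dvd (M : Set N) [SigmaInduction M] (l : N) : ∃ m, 0 < m ∧ ∀ j, j < l → j + 1 ∣ m := by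
  refine SigmaInduction.induction (M := M)
    (fun v => ∃ m, 0 < m ∧ ∀ j, j < v 0 → j + 1 ∣ m) inferInstance (fun _ => 0)
    ⟨1, zero_lt_one, fun j hj => (not_lt_zero hj).elim⟩ ?_ l
  rintro n ⟨m, h0, hm : ∀ j, j < n → j + 1 ∣ m⟩
  refine ⟨m * (n + 1), mul_pos h0 (lt_add_one_iff.2 zero_le), fun j (hj : j < n + 1) => ?_⟩
  rcases (lt_add_one_iff.1 hj).lt_or_eq with h | rfl
  exacts [(hm j h).mul_right _, dvd_mul_left _ _]

theorem exists_pos_forall_mul_add_one_dvd (M : Set N) [SigmaInduction M] (m l : N) :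
    ∃ n, 0 < n ∧ ∀ x, x < l → m * (x + 1) + 1 ∣ n := by
  refine SigmaInduction.induction (M := M)
    (fun v => ∃ n, 0 < n ∧ ∀ x, x < v 0 → v 1 * (x + 1) + 1 ∣ n) inferInstance (fun _ => m)
    ⟨1, zero_lt_one, fun j hj => (not_lt_zero hj).elim⟩ ?_ l
  rintro k ⟨n, h0, hn : ∀ x, x < k → m * (x + 1) + 1 ∣ n⟩
  refine ⟨n * (m * (k + 1) + 1), mul_pos h0 (lt_add_one_iff.2 zero_le),
    fun x (hx : x < k + 1) => show m * (x + 1) + 1 ∣ _ from ?_⟩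
  rcases (lt_add_one_iff.1 hx).lt_or_eq with h | rfl
  exacts [(hn x h).mul_right _, dvd_mul_left _ _]

/-- Every set of the form `{x | p(x) = 1} ∪ {a}` is, below `l`, the set of the `x` for which
`m (x + 1) + 1` divides a suitable divisor of `n₀`. -/
theorem exists_divisor (M : Set N) [SigmaInduction M] {l m n₀ : N} (h0 : 0 < m) (hm : ∀ j, j < l → j + 1 ∣ m) (hn₀ : 0 < n₀)
    (hn : ∀ x, x < l → m * (x + 1) + 1 ∣ n₀) (p a : N) :
    ∃ n, n ≤ n₀ ∧ ∀ x, x < l → (m * (x + 1) + 1 ∣ n ↔ BitOne p x ∨ x = a) := by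
  -- Invariant at k: n₀ = n·e, where n already has the right divisors for indices below k and none
  -- of the others, and e is still divisible by every modulus from k on. Each step moves the modulus
  -- at k from e to n or leaves it in e. Splitting a fixed n₀ keeps n ≤ n₀, which yields a bound on
  -- codes independent of `p` and `a`.
  have key := SigmaInduction.induction (M := M)
    (fun v => v 0 ≤ v 1 → ∃ n e, n * e = v 3 ∧
      (∀ x, x < v 1 → (v 2 * (x + 1) + 1 ∣ n ↔ x < v 0 ∧ (BitOne (v 4) x ∨ x = v 5))) ∧
      ∀ x, x < v 1 → v 0 ≤ x → v 2 * (x + 1) + 1 ∣ e) inferInstance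
    (scons l (scons m (scons n₀ (scons p fun _ => a))))
    (fun _ => ⟨1, n₀, one_mul _, fun x hx => ?_, fun x hx _ => hn x hx⟩) ?_ l le_rfl
  · obtain ⟨n, e, he : n * e = n₀, hx : ∀ x, x < l → (m * (x + 1) + 1 ∣ n ↔ x < l ∧ _), -⟩ := key
    refine ⟨n, ?_, fun x h => (hx x h).trans (and_iff_right h)⟩
    rw [← he]
    refine le_mul_of_one_le_right' ?_
    rw [← zero_add 1, add_one_le_iff]
    exact pos_of_ne_zero fun e0 => by simp [← he, e0] at hn₀
  · show m * (x + 1) + 1 ∣ 1 ↔ x < 0 ∧ _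
    refine iff_of_false (fun h => ?_) fun h => not_lt_zero h.1
    obtain ⟨d, hd⟩ := h
    rcases eq_zero_or_pos d with rfl | hd0
    · simp at hd
    · have h2 : 0 < m * (x + 1) := mul_pos h0 (lt_add_one_iff.2 zero_le)
      have h3 : m * (x + 1) + 1 ≤ (m * (x + 1) + 1) * d :=
        le_mul_of_one_le_right' (by simpa using add_one_le_iff.2 hd0)
      rw [← hd] at h3
      exact (h3.trans_lt (lt_add_of_pos_left 1 h2)).false
  · intro k ih hk
    change k + 1 ≤ l at hk
    obtain ⟨n, e, he, hx, hx'⟩ := ih (le_self_add.trans hk)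
    change n * e = n₀ at he
    change ∀ x, x < l → (m * (x + 1) + 1 ∣ n ↔ x < k ∧ (BitOne p x ∨ x = a)) at hx
    change ∀ x, x < l → k ≤ x → m * (x + 1) + 1 ∣ e at hx'
    show ∃ n e, n * e = n₀ ∧
      (∀ x, x < l → (m * (x + 1) + 1 ∣ n ↔ x < k + 1 ∧ (BitOne p x ∨ x = a))) ∧
      ∀ x, x < l → k + 1 ≤ x → m * (x + 1) + 1 ∣ e
    have hkl := add_one_le_iff.1 hk
    obtain ⟨e', rfl⟩ := hx' k hkl le_rfl
    have hd (x : N) (hxl : x < l) (hkx : k + 1 ≤ x) : m * (x + 1) + 1 ∣ e' := by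
      have := hx' x hxl (le_self_add.trans hkx)
      rw [mul_comm (m * (k + 1) + 1)] at this
      exact dvd_of_dvd_mul_of_ne hm hxl hkl (add_one_le_iff.1 hkx).ne' this
    by_cases hb : BitOne p k ∨ k = a
    · refine ⟨n * (m * (k + 1) + 1), e', by rw [← he]; ring, fun x hxl => ?_, hd⟩
      by_cases hxk : x = k
      · subst hxk
        exact iff_of_true (dvd_mul_left _ _) ⟨lt_add_one_iff.2 le_rfl, hb⟩
      · have : x < k + 1 ↔ x < k := by rw [lt_add_one_iff]; exact ⟨fun h => h.lt_of_ne hxk, le_of_lt⟩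
        rw [this, ← hx x hxl]
        exact ⟨dvd_of_dvd_mul_of_ne hm hxl hkl hxk, fun h => h.mul_right _⟩
    · refine ⟨n, (m * (k + 1) + 1) * e', he, fun x hxl => ?_, fun x hxl h => (hd x hxl h).mul_left _⟩
      rw [hx x hxl, lt_add_one_iff]
      refine ⟨fun h => ⟨h.1.le, h.2⟩, fun h => ⟨h.1.lt_of_ne ?_, h.2⟩⟩
      rintro rfl
      exact hb h.2

/-- The codes of the strings of length at most `l` are bounded, and these strings exist. -/
theorem exists_string_lt (M : Set N) [SigmaInduction M] (l : N) :
    ∃ B, ∀ k p a, k ≤ l → ∃ σ, σ < B ∧ IsString σ k ∧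
      ∀ x, x < k → (BitOne σ x ↔ BitOne p x ∨ x = a) := by
  obtain ⟨m, h0, hm⟩ := exists_pos_forall_add_one_dvd M l
  obtain ⟨n₀, hn0, hn⟩ := exists_pos_forall_mul_add_one_dvd M m l
  refine ⟨pair (pair l m) n₀ + 1, fun k p a hk => ?_⟩
  obtain ⟨n, hle, hn⟩ := exists_divisor M h0 hm hn0 hn p a
  have hq : HasLen (pair (pair k m) n) k ∧
      ∀ x, x < k → (BitOne (pair (pair k m) n) x ↔ BitOne p x ∨ x = a) :=
    ⟨⟨m, n, rfl⟩, fun x hx => by rw [bitOne_pair, and_iff_right hx, hn x (hx.trans_le hk)]⟩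
  -- The code is the least description, hence no larger than the one just found, which is below the
  -- bound because `pair` is monotone.
  obtain ⟨σ, h1, h2⟩ := exists_least (M := M)
    (A := fun v => HasLen (v 0) (v 1) ∧
      ∀ x, x < v 1 → (BitOne (v 0) x ↔ BitOne (v 2) x ∨ x = v 3)) inferInstance
    (scons k (scons p fun _ => a)) ⟨_, hq⟩
  refine ⟨σ, lt_add_one_iff.2 (le_of_not_gt fun hlt => ?_), ⟨h1.1, fun q hq1 hq2 => ?_⟩, h1.2⟩
  · exact h2 (pair (pair k m) n) (lt_of_le_of_lt
      (pair_le_pair (pair_le_pair hk le_rfl) hle) hlt) hq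
  · by_contra! H
    exact h2 q hq1 ⟨hq2, fun x hx => (H x hx).trans (h1.2 x hx)⟩

theorem exists_string (M : Set N) [SigmaInduction M] (k p a : N) :
    ∃ σ, IsString σ k ∧ ∀ x, x < k → (BitOne σ x ↔ BitOne p x ∨ x = a) :=
  let ⟨_, hB⟩ := exists_string_lt M k
  (hB k p a le_rfl).imp fun _ => And.right

/-- `τ` is the prefix of length `k` of `σ`. -/
def IsPrefix (σ k τ : N) : Prop := IsString τ k ∧ ∀ x, x < k → (BitOne τ x ↔ BitOne σ x)

theorem exists_prefix (M : Set N) [SigmaInduction M] (σ k : N) : ∃ τ, IsPrefix σ k τ := by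
  -- The exceptional position `k` is out of range, so nothing is added to `σ`.
  obtain ⟨τ, h, h'⟩ := exists_string M k σ k
  exact ⟨τ, h, fun x hx => (h' x hx).trans (or_iff_left hx.ne)⟩

theorem exists_string_bound (M : Set N) [SigmaInduction M] (l : N) : ∃ B, ∀ σ k, k ≤ l → IsString σ k → σ < B := by
  obtain ⟨B, hB⟩ := exists_string_lt M l
  refine ⟨B, fun σ k hk hσ => ?_⟩
  obtain ⟨τ, h1, h2, h3⟩ := hB k σ k hk
  rwa [hσ.ext h2 fun x hx => ((h3 x hx).trans (or_iff_left hx.ne)).symm]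

theorem exists_append (M : Set N) [SigmaInduction M] {σ l i : N} (hσ : IsString σ l) (hi : i = 0 ∨ i = 1) :
    ∃ τ, IsAppend σ i τ := by
  have hl : ¬ BitOne σ l := fun h => lt_irrefl _ (hσ.1.lt_of_bitOne h)
  have hl1 : l < l + 1 := lt_add_one_iff.2 le_rfl
  rcases hi with rfl | rfl
  · obtain ⟨τ, h1, h2⟩ := exists_prefix M σ (l + 1)
    refine ⟨τ, l, hσ, h1, .inr ⟨(h2 l hl1).not.2 hl, rfl⟩, fun x hx => h2 x (hx.trans hl1)⟩
  · obtain ⟨τ, h1, h2⟩ := exists_string M (l + 1) σ l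
    refine ⟨τ, l, hσ, h1, .inl ⟨(h2 l hl1).2 (.inr rfl), rfl⟩, fun x hx =>
      (h2 x (hx.trans hl1)).trans (or_iff_left hx.ne)⟩

end StringExistence
/-! ### The greedy strings of a martingale approximation -/

section Greedy

variable {N : Type*} [DiscreteSemiring N] {M : Set N}

/-- The entry of `σ` at `k` is `1` if and only if, at stage `s`, the approximation increases from
the prefix `τ` of `σ` of length `k` to `τ0`. -/
def GreedyAt (M : Set N) (s σ k : N) : Prop :=
  ∃ τ τ₀ a b a₀ b₀, IsPrefix σ k τ ∧ IsAppend τ 0 τ₀ ∧ Maps M (pair τ s) (pair a b) ∧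
    Maps M (pair τ₀ s) (pair a₀ b₀) ∧ (BitOne σ k ↔ a * b₀ < a₀ * b)

/-- `σ` is the leftmost string of length `l` along which the approximation at stage `s` does not
increase. -/
def Greedy (M : Set N) (s σ l : N) : Prop := IsString σ l ∧ ∀ k, k < l → GreedyAt M s σ k

section Definability

variable [SigmaInduction M] (f g e : (ℕ → N) → N) [IsTm f] [IsTm g] [IsTm e]

instance : Sig M fun v => IsPrefix (f v) (g v) (e v) :=
  Sig.comp₃ (R := IsPrefix) (by unfold IsPrefix; infer_instance) f g e

instance : Sig M fun v => Maps M (f v) (g v) := by unfold Maps; infer_instance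

instance : Sig M fun v => GreedyAt M (f v) (g v) (e v) :=
  Sig.comp₃ (R := GreedyAt M) (by unfold GreedyAt; infer_instance) f g e

instance : Sig M fun v => Greedy M (f v) (g v) (e v) :=
  Sig.comp₃ (R := Greedy M) (by unfold Greedy; infer_instance) f g e

end Definability

theorem IsAppend.unique {σ i τ τ' : N} (h : IsAppend σ i τ) (h' : IsAppend σ i τ') : τ = τ' := by
  obtain ⟨l, hσ, hτ, hi, hb⟩ := h
  obtain ⟨l', hσ', hτ', hi', hb'⟩ := h'
  obtain rfl := hσ.1.unique hσ'.1
  refine hτ.ext hτ' fun x hx => ?_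
  rcases (lt_add_one_iff.1 hx).lt_or_eq with h | rfl
  · exact (hb x h).trans (hb' x h).symm
  · rcases hi with ⟨h1, rfl⟩ | ⟨h1, rfl⟩ <;> rcases hi' with ⟨h2, h3⟩ | ⟨h2, h3⟩
    · exact iff_of_true h1 h2
    · exact (one_ne_zero h3).elim
    · exact (zero_ne_one h3).elim
    · exact iff_of_false h1 h2

theorem GreedyAt.congr {s σ ρ k : N} (h : GreedyAt M s σ k)
    (hb : ∀ x, x ≤ k → (BitOne ρ x ↔ BitOne σ x)) : GreedyAt M s ρ k := by
  obtain ⟨τ, τ₀, a, b, a₀, b₀, ⟨h1, h1'⟩, h2, h3, h4, h5⟩ := h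
  exact ⟨τ, τ₀, a, b, a₀, b₀, ⟨h1, fun x hx => (h1' x hx).trans (hb x hx.le).symm⟩, h2, h3, h4,
    (hb k le_rfl).trans h5⟩

theorem Greedy.of_prefix {s g l σ k : N} (h : Greedy M s g l) (hkl : k ≤ l) (hσ : IsString σ k)
    (hb : ∀ x, x < k → (BitOne σ x ↔ BitOne g x)) : Greedy M s σ k :=
  ⟨hσ, fun j hj => (h.2 j (hj.trans_le hkl)).congr fun x hx => hb x (hx.trans_lt hj)⟩

/-! ### Greedy strings: uniqueness, existence, bounded capital, stabilization. -/

namespace IsMartingaleApprox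

theorem maps_unique (hM : IsMartingaleApprox M) {z q q' : N} (h : Maps M z q)
    (h' : Maps M z q') : q = q' := by
  obtain ⟨x, y, hx, hy, e⟩ := hM.isFun.1 _ h
  obtain ⟨rfl, rfl⟩ := pair_inj.1 e
  exact (hM.isFun.2 _ hx).unique h h'

theorem exists_maps (hM : IsMartingaleApprox M) {σ l : N} (hσ : IsString σ l) (s : N) :
    ∃ a b, IsRat (pair a b) a b ∧ Maps M (pair σ s) (pair a b) := by
  obtain ⟨q, hq, -⟩ := hM.isFun.2 _ ⟨σ, l, s, hσ, rfl⟩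
  obtain ⟨x, y, hx, ⟨a, b, hab⟩, e⟩ := hM.isFun.1 _ hq
  obtain ⟨rfl, rfl⟩ := pair_inj.1 e
  obtain rfl := hab.1
  exact ⟨a, b, hab, hq⟩

theorem isRat (hM : IsMartingaleApprox M) {z a b : N} (h : Maps M z (pair a b)) :
    IsRat (pair a b) a b := by
  obtain ⟨x, y, hx, ⟨a', b', hab⟩, e⟩ := hM.isFun.1 _ h
  obtain ⟨rfl, rfl⟩ := pair_inj.1 e
  obtain ⟨rfl, rfl⟩ := pair_inj.1 hab.1
  exact hab

variable [SigmaInduction M]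

/-- Strings agreeing below y have the same prefix there, so their entries at y are decided by
comparing the same two values. The case s = s' gives uniqueness, and two late stages give stability.
-/
theorem greedy_agree (hM : IsMartingaleApprox M) {s s' σ σ' l l' k : N} (h : Greedy M s σ l)
    (h' : Greedy M s' σ' l') (hk : k ≤ l) (hk' : k ≤ l')
    (hs : ∀ τ j q, j ≤ k → IsString τ j → Maps M (pair τ s) q → Maps M (pair τ s') q) :
    ∀ y, y < k → (BitOne σ y ↔ BitOne σ' y) := by
  refine SigmaInduction.induction (M := M)
    (fun v => v 0 ≤ v 1 → ∀ y, y < v 0 → (BitOne (v 2) y ↔ BitOne (v 3) y)) inferInstance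
    (scons k (scons σ fun _ => σ')) (fun _ y hy => (not_lt_zero hy).elim) ?_ k le_rfl
  intro j ih hj y (hy : y < j + 1)
  change j + 1 ≤ k at hj
  replace ih : ∀ y, y < j → (BitOne σ y ↔ BitOne σ' y) := ih (le_self_add.trans hj)
  show BitOne σ y ↔ BitOne σ' y
  rcases (lt_add_one_iff.1 hy).lt_or_eq with hlt | rfl
  · exact ih y hlt
  have hyk := add_one_le_iff.1 hj
  obtain ⟨τ, τ₀, a, b, a₀, b₀, h1, h2, h3, h4, h5⟩ := h.2 y (hyk.trans_le hk)
  obtain ⟨τ', τ₀', a', b', a₀', b₀', h1', h2', h3', h4', h5'⟩ := h'.2 y (hyk.trans_le hk')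
  obtain rfl : τ = τ' := h1.1.ext h1'.1 fun x hx =>
    ((h1.2 x hx).trans (ih x hx)).trans (h1'.2 x hx).symm
  obtain rfl := h2.unique h2'
  obtain ⟨l₀, hl₀, hτ₀, -⟩ := h2
  obtain rfl := hl₀.1.unique h1.1.1
  obtain ⟨rfl, rfl⟩ := pair_inj.1 (hM.maps_unique (hs _ _ _ hyk.le h1.1 h3) h3')
  obtain ⟨rfl, rfl⟩ := pair_inj.1 (hM.maps_unique (hs _ _ _ hj hτ₀ h4) h4')
  exact h5.trans h5'.symm

theorem greedy_unique (hM : IsMartingaleApprox M) {s σ σ' l : N} (h : Greedy M s σ l)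
    (h' : Greedy M s σ' l) : σ = σ' :=
  h.1.ext h'.1 (hM.greedy_agree h h' le_rfl le_rfl fun _ _ _ _ _ => id)

/-- If `2 a / b = a₀ / b₀ + a₁ / b₁` and `a / b < a₀ / b₀`, then `a₁ / b₁ ≤ a / b`. -/
theorem le_of_average {a b a₀ b₀ a₁ b₁ : N} (hb₀ : 0 < b₀)
    (h : (1 + 1) * a * (b₀ * b₁) = b * (a₀ * b₁ + a₁ * b₀)) (hlt : a * b₀ < a₀ * b) :
    a₁ * b ≤ a * b₁ := by
  have h1 : a * b₀ * b₁ ≤ a₀ * b * b₁ := by gcongr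
  have h2 : a₁ * b * b₀ ≤ a * b₁ * b₀ := by
    have e1 : (1 + 1) * a * (b₀ * b₁) = a * b₀ * b₁ + a * b₁ * b₀ := by ring
    have e2 : b * (a₀ * b₁ + a₁ * b₀) = a₀ * b * b₁ + a₁ * b * b₀ := by ring
    rw [e1, e2] at h
    grind
  exact le_of_mul_le_mul_right h2 hb₀

theorem le_trans_frac {a b c d e f : N} (hd : 0 < d) (h : a * d ≤ c * b) (h' : c * f ≤ e * d) :
    a * f ≤ e * b := by
  refine le_of_mul_le_mul_right (a := d) ?_ hd
  calc a * f * d = a * d * f := by ring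
    _ ≤ c * b * f := by gcongr
    _ = c * f * b := by ring
    _ ≤ e * d * b := by gcongr
    _ = e * b * d := by ring

/-- Existence and the capital bound are proved together, as one Σ⁰₁ statement suited to induction on
the length. -/
theorem exists_greedy_le (hM : IsMartingaleApprox M) {s ε c d : N} (hε : IsString ε 0)
    (hc : Maps M (pair ε s) (pair c d)) (l : N) :
    ∃ σ a b, Greedy M s σ l ∧ Maps M (pair σ s) (pair a b) ∧ a * d ≤ c * b := by
  refine SigmaInduction.induction (M := M)
    (fun v => ∃ σ a b, Greedy M (v 1) σ (v 0) ∧ Maps M (pair σ (v 1)) (pair a b) ∧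
      a * v 3 ≤ v 2 * b) inferInstance (scons s (scons c fun _ => d))
    ⟨ε, c, d, ⟨hε, fun k hk => (not_lt_zero hk).elim⟩, hc, le_rfl⟩ ?_ l
  rintro l ⟨σ, a, b, hσ, hab, hle⟩
  change Greedy M s σ l at hσ
  change Maps M (pair σ s) (pair a b) at hab
  change a * d ≤ c * b at hle
  show ∃ σ a b, Greedy M s σ (l + 1) ∧ Maps M (pair σ s) (pair a b) ∧ a * d ≤ c * b
  obtain ⟨τ₀, h₀⟩ := exists_append M hσ.1 (.inl rfl)
  obtain ⟨τ₁, h₁⟩ := exists_append M hσ.1 (.inr rfl)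
  obtain ⟨l₀, hl₀, hτ₀, hv₀, hp₀⟩ := id h₀
  obtain rfl := hl₀.1.unique hσ.1.1
  obtain ⟨l₁, hl₁, hτ₁, hv₁, hp₁⟩ := id h₁
  obtain rfl := hl₁.1.unique hσ.1.1
  obtain ⟨a₀, b₀, hr₀, hm₀⟩ := hM.exists_maps hτ₀ s
  obtain ⟨a₁, b₁, hr₁, hm₁⟩ := hM.exists_maps hτ₁ s
  have hr := hM.isRat hab
  have avg := hM.average _ _ _ s h₀ h₁ _ _ _ _ _ _ _ _ _ hr hr₀ hr₁ hab hm₀ hm₁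
  have step {ρ : N} (hρ : IsString ρ (l₁ + 1)) (hp : ∀ x, x < l₁ → (BitOne ρ x ↔ BitOne σ x))
      (hv : BitOne ρ l₁ ↔ a * b₀ < a₀ * b) : Greedy M s ρ (l₁ + 1) := by
    refine ⟨hρ, fun k hk => ?_⟩
    rcases (lt_add_one_iff.1 hk).lt_or_eq with h | rfl
    · exact (hσ.2 k h).congr fun x hx => hp x (hx.trans_lt h)
    · exact ⟨σ, τ₀, a, b, a₀, b₀, ⟨hσ.1, fun x hx => (hp x hx).symm⟩, h₀, hab, hm₀, hv⟩
  -- If the capital rises towards 0, averaging makes 1 safe; otherwise 0 itself is safe.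
  by_cases hlt : a * b₀ < a₀ * b
  · have hv : BitOne τ₁ l₁ := (hv₁.resolve_right fun h => one_ne_zero h.2).1
    exact ⟨τ₁, a₁, b₁, step hτ₁ hp₁ (iff_of_true hv hlt), hm₁,
      le_trans_frac hr.2.1 (le_of_average hr₀.2.1 avg hlt) hle⟩
  · have hv : ¬ BitOne τ₀ l₁ := (hv₀.resolve_left fun h => zero_ne_one h.2).1
    exact ⟨τ₀, a₀, b₀, step hτ₀ hp₀ (iff_of_false hv hlt), hm₀,
      le_trans_frac hr.2.1 (not_lt.1 hlt) hle⟩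

theorem exists_greedy (hM : IsMartingaleApprox M) (s l : N) : ∃ σ, Greedy M s σ l := by
  obtain ⟨ε, hε, -⟩ := exists_string M 0 0 0
  obtain ⟨c, d, -, hc⟩ := hM.exists_maps hε s
  obtain ⟨σ, -, -, h, -⟩ := hM.exists_greedy_le hε hc l
  exact ⟨σ, h⟩

/-- The approximations stabilize simultaneously for the strings of length at most `l`. -/
theorem exists_stage_forall (hM : IsMartingaleApprox M) {S : Set (Set N)} (hB : BPi01 S)
    (hS : M ∈ S) (l : N) :
    ∃ u, ∀ τ j s t q, j ≤ l → IsString τ j → u ≤ s → u ≤ t → Maps M (pair τ s) q →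
      Maps M (pair τ t) q := by
  obtain ⟨B, hlt⟩ := exists_string_bound M l
  obtain ⟨φ, hφ⟩ := Pi.exists_formula (M := M) (P := fun v => ∀ s t q r, v 0 ≤ s → v 0 ≤ t →
    Maps M (pair (v 1) s) q → Maps M (pair (v 1) t) r → q = r) inferInstance
  -- Being a stage from which M(τ,·) is constant is Π⁰₁ and persists upwards, so a bound on such
  -- stages for all τ < B is itself such a stage for all of them.
  obtain ⟨m, hm⟩ := hB φ (fun _ => 0) (fun _ => M) (fun _ => hS) B fun τ _ => by
    by_cases h : ∃ k, IsString τ k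
    · obtain ⟨k, hk⟩ := h
      obtain ⟨u, hu⟩ := hM.limit τ k hk
      refine ⟨u, (hφ _).1 fun s t q r hs ht => ?_⟩
      exact hu s t (leq_iff.2 hs) (leq_iff.2 ht) q r
    -- A number that codes no string is outside the domain of `M`, so any stage works.
    · refine ⟨0, (hφ _).1 fun s t q r _ _ hq => ?_⟩
      obtain ⟨x, y, ⟨τ', k, s', hk, e⟩, -, e'⟩ := hM.isFun.1 _ hq
      obtain ⟨rfl, -⟩ := pair_inj.1 e'
      obtain ⟨rfl : τ = τ', -⟩ := pair_inj.1 e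
      exact (h ⟨k, hk⟩).elim
  refine ⟨m, fun τ j s t q hj hτ hs ht hq => ?_⟩
  obtain ⟨u, hu, h⟩ := hm τ (hlt τ j hj hτ)
  obtain ⟨a, b, -, hr⟩ := hM.exists_maps hτ t
  have h := (hφ _).2 h s t q _ (hu.le.trans hs) (hu.le.trans ht) hq hr
  rwa [h]

end IsMartingaleApprox

/-! ### The greedy coloring: definability, stability, failure of `M`. -/

/-- The coloring whose value at `(x, s)` is the entry at `x` of the greedy string of length `s` at
stage `s`. -/
def greedyColoring (M : Set N) : Set N :=
  {z | ∃ x s i σ, z = pair (pair x s) i ∧ x < s ∧ Greedy M s σ s ∧ StringVal σ x i}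

theorem maps_greedyColoring {x s i : N} :
    Maps (greedyColoring M) (pair x s) i ↔ x < s ∧ ∃ σ, Greedy M s σ s ∧ StringVal σ x i := by
  refine ⟨?_, fun ⟨h, σ, h1, h2⟩ => ⟨x, s, i, σ, rfl, h, h1, h2⟩⟩
  rintro ⟨x', s', i', σ, e, h, h'⟩
  obtain ⟨e', rfl⟩ := pair_inj.1 e
  obtain ⟨rfl, rfl⟩ := pair_inj.1 e'
  exact ⟨h, σ, h'⟩

theorem stringVal_congr {σ τ x i : N} (h : BitOne σ x ↔ BitOne τ x) :
    StringVal σ x i ↔ StringVal τ x i := by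
  unfold StringVal; rw [h]

theorem StringVal.eq {σ x i j : N} (h : StringVal σ x i) (h' : StringVal σ x j) : i = j := by
  unfold StringVal at h h'; grind

theorem exists_stringVal (σ x : N) : ∃ i, StringVal σ x i := by
  unfold StringVal; by_cases h : BitOne σ x <;> simp [h]

namespace IsMartingaleApprox

variable [SigmaInduction M]

/-- Since there is exactly one greedy string of each length, "some greedy string" may be replaced by
"every greedy string", which gives the Π⁰₁ definition. -/
theorem mem_greedyColoring_iff (hM : IsMartingaleApprox M) {z : N} :
    z ∈ greedyColoring M ↔ ∃ x, x < z + 1 ∧ ∃ s, s < z + 1 ∧ ∃ i, i < z + 1 ∧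
      z = pair (pair x s) i ∧ x < s ∧ ∀ σ, Greedy M s σ s → StringVal σ x i := by
  constructor
  · rintro ⟨x, s, i, σ, rfl, h, h1, h2⟩
    refine ⟨x, lt_add_one_iff.2 ((le_pair_left _ _).trans (le_pair_left _ _)), s,
      lt_add_one_iff.2 ((le_pair_right _ _).trans (le_pair_left _ _)), i,
      lt_add_one_iff.2 (le_pair_right _ _), rfl, h, fun τ hτ => ?_⟩
    rwa [hM.greedy_unique hτ h1]
  · rintro ⟨x, -, s, -, i, -, rfl, h, h1⟩
    obtain ⟨σ, hσ⟩ := hM.exists_greedy s s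
    exact ⟨x, s, i, σ, rfl, h, hσ, h1 σ hσ⟩

theorem exists_definitions (hM : IsMartingaleApprox M) : ∃ φ ψ : Fm, ∀ (v : ℕ → N) (n : N),
    (n ∈ greedyColoring M ↔ SigmaSat (fun _ => M) (scons n v) φ) ∧
    (n ∈ greedyColoring M ↔ PiSat (fun _ => M) (scons n v) ψ) := by
  have h1 : Sig M fun v => ∃ x s i σ, v 0 = pair (pair x s) i ∧ x < s ∧ Greedy M s σ s ∧
    StringVal σ x i := inferInstance
  have h2 : Pi M fun v => ∃ x, x < v 0 + 1 ∧ ∃ s, s < v 0 + 1 ∧ ∃ i, i < v 0 + 1 ∧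
    v 0 = pair (pair x s) i ∧ x < s ∧ ∀ σ, Greedy M s σ s → StringVal σ x i := inferInstance
  obtain ⟨φ, hφ⟩ := h1.out
  obtain ⟨ψ, hψ⟩ := h2.exists_formula
  exact ⟨φ, ψ, fun v n => ⟨hφ (scons n v), hM.mem_greedyColoring_iff.trans (hψ (scons n v))⟩⟩

theorem isStableColoring (hM : IsMartingaleApprox M) {S : Set (Set N)} (hB : BPi01 S)
    (hS : M ∈ S) : IsStableColoring (greedyColoring M) := by
  refine ⟨⟨?_, ?_⟩, fun x => ?_⟩
  · rintro _ ⟨x, s, i, σ, rfl, h, -, h2⟩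
    exact ⟨_, i, ⟨x, s, h, rfl⟩, (h2.imp And.right And.right).symm, rfl⟩
  · rintro _ ⟨x, s, h, rfl⟩
    obtain ⟨σ, hσ⟩ := hM.exists_greedy s s
    obtain ⟨i, hi⟩ := exists_stringVal σ x
    refine ⟨i, maps_greedyColoring.2 ⟨h, σ, hσ, hi⟩, fun j hj => ?_⟩
    obtain ⟨-, τ, hτ, hj⟩ := maps_greedyColoring.1 hj
    rw [hM.greedy_unique hτ hσ] at hj
    exact hj.eq hi
  · obtain ⟨u, hu⟩ := hM.exists_stage_forall hB hS (x + 1)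
    -- The reference stage must also exceed `x`, for otherwise the greedy string has no entry at
    -- `x`.
    obtain ⟨g, hg⟩ := hM.exists_greedy (max u (x + 1)) (max u (x + 1))
    obtain ⟨i, hi⟩ := exists_stringVal g x
    refine ⟨max u (x + 1), i, fun t ht => ?_⟩
    rw [leq_iff] at ht
    have hut := (le_max_left _ _).trans ht
    have hxt := (le_max_right _ _).trans ht
    obtain ⟨σ, hσ⟩ := hM.exists_greedy t t
    refine maps_greedyColoring.2 ⟨add_one_le_iff.1 hxt, σ, hσ, ?_⟩
    refine (stringVal_congr ?_).2 hi
    exact hM.greedy_agree hσ hg hxt (le_max_right _ _)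
      (fun τ j q hj hτ => hu τ j t _ q hj hτ hut (le_max_left _ _)) x (lt_add_one_iff.2 le_rfl)

theorem not_succeedsOn (hM : IsMartingaleApprox M) : ¬ SucceedsOn M (greedyColoring M) := by
  obtain ⟨ε, hε, -⟩ := exists_string M 0 0 0
  obtain ⟨u, hu⟩ := hM.limit ε 0 hε
  obtain ⟨c, d, hcd, hc⟩ := hM.exists_maps hε u
  intro H
  -- The limit of M(ε,·) is c/d ≤ c, so the threshold `c` should never be passed.
  obtain ⟨σ, l, s, hσ, H⟩ := H c
  obtain ⟨h1, q, a, b, hq, h2, -, hlt⟩ := H (max s u) (leq_iff.2 (le_max_left _ _))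
  set t := max s u
  obtain ⟨c', d', -, hc'⟩ := hM.exists_maps hε t
  obtain ⟨rfl, rfl⟩ := pair_inj.1 (hu u t (.inr rfl) (leq_iff.2 (le_max_right _ _)) _ _ hc hc')
  obtain ⟨g, hg⟩ := hM.exists_greedy t t
  -- f(x,t) is defined only for x < t, so a string matching f(·,t) has length at most `t`.
  have hlt' : l ≤ t := by
    by_contra! hl
    obtain ⟨i, -, hi⟩ := h1 t hl
    exact lt_irrefl _ (maps_greedyColoring.1 hi).1
  have hσg : Greedy M t σ l := hg.of_prefix hlt' hσ fun x hx => by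
    obtain ⟨i, hi, hf⟩ := h1 x hx
    obtain ⟨-, g', hg', hi'⟩ := maps_greedyColoring.1 hf
    rw [hM.greedy_unique hg' hg] at hi'
    unfold StringVal at hi hi'
    have : (0 : N) ≠ 1 := zero_ne_one
    grind
  obtain ⟨σ', a', b', hσ', hm, hle⟩ := hM.exists_greedy_le hε hc' l
  obtain rfl := hM.greedy_unique hσ' hσg
  obtain rfl := hq.1
  obtain ⟨rfl, rfl⟩ := pair_inj.1 (hM.maps_unique hm h2)
  -- Now a' ≤ a'·d ≤ c·b' < a', a contradiction.
  have h3 : a' ≤ a' * d := le_mul_of_one_le_right' (by simpa using add_one_le_iff.2 hcd.2.1)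
  exact ((hlt.trans_le h3).trans_le hle).false

end IsMartingaleApprox

/-- The two definitions of the greedy coloring serve twice: Δ⁰₁ comprehension puts it into `S`, and
they witness reducibility to `M`. -/
theorem exists_stableColoring_not_succeedsOn {S : Set (Set N)} (hRCA : RCA0 S) (hB : BPi01 S) :
    ∀ M ∈ S, IsMartingaleApprox M →
      ∃ f ∈ S, IsStableColoring f ∧ TuringLE f M ∧ ¬ SucceedsOn M f := by
  intro M hS hM
  have : SigmaInduction M := ⟨fun P hP w => hRCA.induction_sig hS hP w⟩
  obtain ⟨φ, ψ, h⟩ := hM.exists_definitions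
  obtain ⟨Y, hY, hYf⟩ := hRCA.delta_comprehension φ ψ (fun _ => 0) (fun _ => M) (fun _ => hS)
    fun n => (h _ n).1.symm.trans (h _ n).2
  obtain rfl : Y = greedyColoring M := Set.ext fun n => (hYf n).trans (h _ n).1.symm
  exact ⟨_, hY, hM.isStableColoring hB hS, ⟨φ, ψ, fun _ => 0, h _⟩, hM.not_succeedsOn⟩

end Greedy
end SOA

/-- Every model `(N, S)` of `RCA₀ + BΠ⁰₁` satisfies: for every martingale approximation `M` there
is a stable coloring `f ≤_T M` on which `M` does not succeed. -/
theorem mainTheorem10 {N : Type*} [Zero N] [One N] [Add N] [Mul N] [LT N] (S : Set (Set N))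
    (hRCA : SOA.RCA0 S) (hB : SOA.BPi01 S) :
    ∀ M ∈ S, SOA.IsMartingaleApprox M →
      ∃ f ∈ S, SOA.IsStableColoring f ∧ SOA.TuringLE f M ∧ ¬ SOA.SucceedsOn M f :=
  letI := hRCA.discreteSemiring
  SOA.exists_stableColoring_not_succeedsOn hRCA hB
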